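/- **Setting.** Let $M$ be a non-empty compact Riemannian manifold (smooth, without boundary, not necessarily connected) of dimension $d\ge 1$ with Riemannian distance $d_M$, and let $\nu$ be its Riemannian volume (the $d$-dimensional Hausdorff measure of $d_M$, suitably scaled), normalized to a probability measure. Let $\Gamma$ be a group with a finite symmetric generating set $S$ acting on $M$ by isometries, and let $E\neq 0$ be a real Banach space. The action has *$E$-spectral gap* if there is $\varepsilon>0$ such that $\max_{s\in S}\|f-s\cdot f\|\ge\varepsilon\|f\|$ for every $f\in L^2(M,\nu;E)$ with $\int_M f\,d\nu=0$, where $(s\cdot f)(x)=f(s^{-1}x)$ and $\|\cdot\|$ is the norm of $L^2(M,\nu;E)$. For a partition $\mathcal P$ of $M$ into finitely many non-empty measurable regions, the *approximating graph* $\mathcal G_{\mathcal P}$ has the regions as vertices, and two distinct regions $R,R'$ are joined by an edge if $\nu(sR\cap R')>0$ for some $s\in S$. For $t\ge 1$, call $\mathcal P$ a *level-$t$ partition* if there is a set $Y\subset M$ that is $\frac1t$-separated ($d_M(y,y')\ge\frac1t$ for distinct $y,y'\in Y$) and $\frac1t$-dense (the open balls $B(y,\frac1t)$, $y\in Y$,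 cover $M$) and a bijection $y\mapsto R_y$ from $Y$ to $\mathcal P$ with $B(y,\frac1{2t})\subseteq R_y\subseteq B(y,\frac1t)$. The approximating graph of a level-$t$ partition is denoted by $\mathcal G_t(\Gamma\curvearrowright M)$; these are the graphs approximating the $t$-levels of the warped cone of the action. A sequence of finite connected graphs $\mathcal G_n$ with vertex sets $V_n$ is an *expander* if the degrees are bounded uniformly in $n$, $|V_n|\to\infty$, and there is $c>0$ such that $|\partial A|\ge c|A|$ for all $n$ and all non-empty $A\subset V_n$ with $|A|\le\frac12|V_n|$, where $\partial A$ is the set of edges between $A$ and $V_n\setminus A$. It *coarsely embeds into $E$* if there are non-decreasing unbounded functions $\rho_-,\rho_+\colon[0,\infty)\to[0,\infty)$ and maps $f_n\colon V_n\to E$ with $\rho_-(d_n(v,w))\le\|f_n(v)-f_n(w)\|\le\rho_+(d_n(v,w))$ for all $n$ and all $v,w\in V_n$, where $d_n$ is the shortest path distance of $\mathcal G_n$. **Theorem.** Suppose that the action $\Gamma\curvearrowright M$ has $E$-spectral gap. Then: 1. For every $t\ge 1$ there is a level-$t$ partition of $M$. 2. For every non-decreasing sequence $(t_n)$ in $[1,\infty)$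 with $t_n\to\infty$ and every choice of level-$t_n$ partitions, the graphs $\mathcal G_{t_n}(\Gamma\curvearrowright M)$ form an expander that does not coarsely embed into $E$. 3. More generally, let $(t_n)$ be as in 2 and let $\mathcal P_n$ be finite measurable partitions of $M$ for which there are constants $C,Q,D$ such that, for all $n$, every region of $\mathcal P_n$ has diameter at most $C/t_n$, $\nu(R)\le Q\,\nu(R')$ for all $R,R'\in\mathcal P_n$, and $\mathcal G_{\mathcal P_n}$ has degree at most $D$. Then the graphs $\mathcal G_{\mathcal P_n}$ form an expander that does not coarsely embed into $E$. -/

import Mathlib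

open MeasureTheory Filter Set
open Bundle
open scoped ENNReal NNReal Manifold ContDiff Topology

noncomputable section

/-! ### Graphs: Cheeger constant, expanders, coarse embeddings -/

/-- The number of edges joining an element of `A` with an element outside `A`. -/
def edgeBoundaryCard {V : Type*} (G : SimpleGraph V) (A : Finset V) : ℕ :=
  {e ∈ G.edgeSet | ∃ v ∈ A, ∃ w ∉ A, e = s(v, w)}.ncard

/-- The Cheeger constant: the minimum of `|∂A| / |A|` over the non-empty sets `A` of at most half
of the vertices.  It takes values in `[0, ∞]`; for a graph with a single vertex there is no such
set `A` and the value is `∞`. -/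
def cheegerConstant {V : Type*} (G : SimpleGraph V) : ℝ≥0∞ :=
  ⨅ A ∈ {A : Finset V | A.Nonempty ∧ 2 * A.card ≤ Nat.card V},
    (edgeBoundaryCard G A : ℝ≥0∞) / (A.card : ℝ≥0∞)

/-- All vertices have at most `D` neighbours. -/
def DegreeBoundedBy {V : Type*} (G : SimpleGraph V) (D : ℕ) : Prop :=
  ∀ v, (G.neighborSet v).Finite ∧ (G.neighborSet v).ncard ≤ D

/-- A sequence of finite connected graphs is an expander if the degrees are uniformly bounded, the
number of vertices tends to infinity, and the Cheeger constants are bounded away from zero. -/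
structure IsExpander {V : ℕ → Type*} (G : ∀ n, SimpleGraph (V n)) : Prop where
  finite : ∀ n, Finite (V n)
  connected : ∀ n, (G n).Connected
  degree_bounded : ∃ D : ℕ, ∀ n, DegreeBoundedBy (G n) D
  card_tendsto : Tendsto (fun n => Nat.card (V n)) atTop atTop
  cheeger : ∃ C : ℝ≥0, 0 < C ∧ ∀ n, (C : ℝ≥0∞) ≤ cheegerConstant (G n)

/-- A control function: an increasing unbounded function `[0,∞) → [0,∞)`. -/
def IsControlFunction (ρ : ℝ≥0 → ℝ≥0) : Prop :=
  Monotone ρ ∧ ∀ C : ℝ≥0, ∃ r : ℝ≥0, C < ρ r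

/-- `f` is a coarse embedding of the vertex set of `G`, with the shortest path distance, into the
metric space `Y`, with control functions `ρ₁` (lower) and `ρ₂` (upper). -/
def IsCoarseEmbeddingWith {V Y : Type*} [PseudoMetricSpace Y] (G : SimpleGraph V)
    (ρ₁ ρ₂ : ℝ≥0 → ℝ≥0) (f : V → Y) : Prop :=
  ∀ v w, ρ₁ (G.dist v w : ℝ≥0) ≤ nndist (f v) (f w) ∧
    nndist (f v) (f w) ≤ ρ₂ (G.dist v w : ℝ≥0)

/-- A sequence of graphs coarsely embeds into `Y` if there are coarse embeddings of all of them
with the same control functions. -/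
def CoarselyEmbeds {V : ℕ → Type*} (G : ∀ n, SimpleGraph (V n)) (Y : Type*)
    [PseudoMetricSpace Y] : Prop :=
  ∃ ρ₁ ρ₂ : ℝ≥0 → ℝ≥0, IsControlFunction ρ₁ ∧ IsControlFunction ρ₂ ∧
    ∃ f : ∀ n, V n → Y, ∀ n, IsCoarseEmbeddingWith (G n) ρ₁ ρ₂ (f n)

/-! ### Spectral gap -/

/-- `E`-spectral gap of an action on `(X, ν)` with respect to the finite set `S`: there is `ε > 0`
with `max_{s ∈ S} ‖f - s·f‖ ≥ ε ‖f‖` for all square integrable `f : X → E` of zero mean, where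
`(s·f)(x) = f(s⁻¹x)` and the norm is that of the Bochner space `L²(X, ν; E)`. -/
def HasSpectralGap {Γ X : Type*} [Group Γ] [MulAction Γ X] [MeasurableSpace X]
    (S : Finset Γ) (ν : Measure X) (E : Type*) [NormedAddCommGroup E] [NormedSpace ℝ E] : Prop :=
  ∃ ε : ℝ≥0, 0 < ε ∧ ∀ f : X → E, MemLp f 2 ν → ∫ x, f x ∂ν = 0 →
    ∃ s ∈ S, (ε : ℝ≥0∞) * eLpNorm f 2 ν ≤ eLpNorm (fun x => f x - f (s⁻¹ • x)) 2 ν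

/-! ### Approximating graphs -/

/-- The approximating graph of an action with respect to a finite partition: the vertices are the
regions, and two distinct regions `R`, `R'` are joined by an edge if `sR ∩ R'` has positive measure
for some `s ∈ S` (or the same with `R` and `R'` exchanged, which makes no difference if `S` is
symmetric and the action preserves `ν`). -/
def approxGraph {Γ X : Type*} [Group Γ] [MulAction Γ X] [MeasurableSpace X]
    (S : Finset Γ) (ν : Measure X) (P : Finpartition (univ : Set X)) :
    SimpleGraph {R : Set X // R ∈ P.parts} :=
  SimpleGraph.fromRel fun R R' => ∃ s ∈ S, 0 < ν (((fun x => s • x) '' R.1) ∩ R'.1)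

/-- All regions are measurable. -/
def IsMeasurablePartition {X : Type*} [MeasurableSpace X] (P : Finpartition (univ : Set X)) :
    Prop :=
  ∀ R ∈ P.parts, MeasurableSet R

/-- `Q`-bounded measure ratios: `ν(R) / ν(R') ≤ Q` for all regions.  For a probability measure this
forces all regions to have positive measure. -/
def HasBoundedMeasureRatios {X : Type*} [MeasurableSpace X] (ν : Measure X)
    (P : Finpartition (univ : Set X)) (Q : ℝ≥0) : Prop :=
  ∀ R ∈ P.parts, ∀ R' ∈ P.parts, ν R ≤ Q * ν R'

/-- The mesh (the maximal diameter of a region) is at most `r`. -/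
def MeshLE {X : Type*} [PseudoEMetricSpace X] (P : Finpartition (univ : Set X)) (r : ℝ) : Prop :=
  ∀ R ∈ P.parts, Metric.ediam R ≤ ENNReal.ofReal r

/-- A partition at scale `1/t`, as used for the level `t` of the warped cone: the regions are
measurable and in bijection with the points of a `1/t`-separated and `1/t`-dense set, and the region
of the point `y` lies between the balls `B(y, 1/(2t))` and `B(y, 1/t)`.  Voronoi tessellations (with
ties broken measurably) are of this kind. -/
structure IsLevelPartition {X : Type*} [PseudoEMetricSpace X] [MeasurableSpace X]
    (t : ℝ) (P : Finpartition (univ : Set X)) : Prop where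
  measurable : IsMeasurablePartition P
  exists_net : ∃ y : {R : Set X // R ∈ P.parts} → X,
    (∀ R R', R ≠ R' → ENNReal.ofReal (1 / t) ≤ edist (y R) (y R')) ∧
    (∀ x, ∃ R, edist x (y R) < ENNReal.ofReal (1 / t)) ∧
    ∀ R, Metric.eball (y R) (ENNReal.ofReal (1 / (2 * t))) ⊆ R.1 ∧
      R.1 ⊆ Metric.eball (y R) (ENNReal.ofReal (1 / t))

/-! ### The probability measure of a compact Riemannian manifold -/

/-- The Riemannian volume of a `d`-dimensional Riemannian manifold, that is, the `d`-dimensional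
Hausdorff measure of the Riemannian distance (scaled to agree with Lebesgue measure on Euclidean
space), normalized to total mass one. -/
def normalizedVolume (d : ℕ) (M : Type*) [EMetricSpace M] [MeasurableSpace M] [BorelSpace M] :
    Measure M :=
  ((μHE[d] : Measure M) univ)⁻¹ • (μHE[d] : Measure M)

end

/-! A function on the vertices of an approximating graph is the same as a function on `M` that is
constant on the regions, so the spectral gap can be tested on it after subtracting its mean `m`. For
the element `s` it provides, `‖F - s·F‖²` is the sum of `‖f v - f w‖² ν(v ∩ s w)`. Only pairs with
`ν(v ∩ s w) > 0` contribute, that is, edges (and pairs `v = w`, whose terms vanish). When all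
regions have comparable measure the weights cancel, which leaves an `E`-valued Poincaré inequality
on the graph with a constant `Q² / ε²` that depends on neither the partition nor its scale
(`sum_enorm_sub_sq_le`, `hasPoincareInequality_approxGraph`).

Such an inequality gives everything else (`isExpander_and_not_coarselyEmbeds`). Applied to the
indicator of a vertex set times a unit vector of `E`, it bounds the Cheeger constant from below and
forces connectedness. Applied to a coarse embedding, it places at least half of the vertices in a
ball of `E` of fixed radius, hence in a ball of the graph of fixed radius; bounded degrees limit the
size of the latter, while the number of vertices grows.

For level partitions, bounded degrees and comparable measures must be proved. Both follow from
`exists_normalizedVolume_eball_le`: balls of radii `5ρ` and `ρ` have comparable volume, whatever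
their centres. This comes from Ahlfors regularity of the Hausdorff measure, which bi-Lipschitz
charts (`exists_bilipschitz_chart`) transfer from Euclidean space and compactness makes uniform.
Level partitions themselves are Voronoi tessellations of maximal separated sets. -/

theorem ContinuousLinearMap.enorm_apply_le_of_enorm_lt {V W : Type*} [NormedAddCommGroup V]
    [NormedSpace ℝ V] [NormedAddCommGroup W] [NormedSpace ℝ W] (f : V →L[ℝ] W) {C : ℝ≥0∞}
    (h : ‖f‖ₑ < C) (v : V) : ‖f v‖ₑ ≤ C * ‖v‖ₑ :=
  (f.le_opENorm v).trans (by gcongr)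

/-! ### Charts of a Riemannian manifold are locally bi-Lipschitz. -/

section Riemannian

variable {E : Type*} [NormedAddCommGroup E] [NormedSpace ℝ E]
  {H : Type*} [TopologicalSpace H] (I : ModelWithCorners ℝ E H)
  {M : Type*} [TopologicalSpace M] [ChartedSpace H M]
  [RiemannianBundle (fun x : M => TangentSpace I x)]
  [IsManifold I 1 M] [IsContinuousRiemannianBundle E (fun x : M => TangentSpace I x)]

open Manifold Metric

/-- The derivative of the extended chart is locally bounded. -/
theorem eventually_enorm_mfderiv_extChartAt_apply_le (x : M) : ∃ C > (0 : ℝ≥0), ∀ᶠ y in 𝓝 x, ∀ v : TangentSpace I y,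
    ‖(id (mfderiv I 𝓘(ℝ, E) (extChartAt I x) y v) : E)‖ₑ ≤ C * ‖v‖ₑ := by
  obtain ⟨C, C_pos, hC⟩ := eventually_enorm_mfderiv_extChartAt_lt I x
  refine ⟨C, C_pos, ?_⟩
  filter_upwards [hC] with y hy v
  -- The norm on the target is that of a tangent space of the vector space `E`; its instances are
  -- supplied by hand.
  exact @ContinuousLinearMap.enorm_apply_le_of_enorm_lt _ _ _ _
    (normedAddCommGroupTangentSpaceVectorSpace _)
    (normedSpaceTangentSpaceVectorSpace _) _ _ hy v

/-- The derivative of the inverse of the extended chart is locally bounded. -/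
theorem eventually_enorm_mfderivWithin_symm_extChartAt_apply_le (x : M) : ∃ C > (0 : ℝ≥0), ∀ᶠ y in 𝓝[range I] (extChartAt I x x), ∀ v : E,
    ‖(mfderivWithin 𝓘(ℝ, E) I (extChartAt I x).symm (range I) y v)‖ₑ ≤ C * ‖v‖ₑ := by
  obtain ⟨C, C_pos, hC⟩ := eventually_enorm_mfderivWithin_symm_extChartAt_lt I x
  refine ⟨C, C_pos, ?_⟩
  filter_upwards [hC] with y hy v
  exact @ContinuousLinearMap.enorm_apply_le_of_enorm_lt _ _
    (normedAddCommGroupTangentSpaceVectorSpace _)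
    (normedSpaceTangentSpaceVectorSpace _) _ _ _ _ hy v

/-- The inverse of the extended chart at `x` is Lipschitz near the image of `x`. -/
theorem exists_riemannianEDist_extChartAt_symm_le (x : M) :
    ∃ C > (0 : ℝ≥0), ∃ r > 0, ball (extChartAt I x x) r ∩ range I ⊆ (extChartAt I x).target ∧
      ∀ a ∈ ball (extChartAt I x x) r ∩ range I, ∀ b ∈ ball (extChartAt I x x) r ∩ range I,
        riemannianEDist I ((extChartAt I x).symm a) ((extChartAt I x).symm b) ≤ C * edist a b := by
  rcases eventually_enorm_mfderivWithin_symm_extChartAt_apply_le I x with ⟨C, C_pos, hC⟩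
  obtain ⟨r, r_pos, hr⟩ : ∃ r > 0,
      ball (extChartAt I x x) r ∩ range I ⊆ (extChartAt I x).target ∩
        {y | ∀ v : E, ‖mfderivWithin 𝓘(ℝ, E) I (extChartAt I x).symm (range I) y v‖ₑ ≤ C * ‖v‖ₑ} :=
    mem_nhdsWithin_iff.1 (inter_mem (extChartAt_target_mem_nhdsWithin x) hC)
  refine ⟨C, C_pos, r, r_pos, hr.trans inter_subset_left, fun a ha b hb => ?_⟩
  -- The competitor path is the image of the straight segment from `a` to `b`, which stays in the
  -- convex set `ball ∩ range I` where the derivative is bounded.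
  let η := ContinuousAffineMap.lineMap (R := ℝ) a b
  set γ := (extChartAt I x).symm ∘ η
  have hη : Icc 0 1 ⊆ ⇑η ⁻¹' ((extChartAt I x).target ∩
        {y | ∀ v : E, ‖mfderivWithin 𝓘(ℝ, E) I (extChartAt I x).symm (range I) y v‖ₑ ≤ C * ‖v‖ₑ}) := by
    simp only [← image_subset_iff, ContinuousAffineMap.coe_lineMap_eq,
     ← segment_eq_image_lineMap, η]
    exact (((convex_ball _ _).inter I.convex_range).segment_subset ha hb).trans hr
  simp only [preimage_inter, subset_inter_iff] at hη
  have η_smooth : CMDiff[Icc 0 1] 1 η := by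
    apply ContMDiff.contMDiffOn
    rw [contMDiff_iff_contDiff]
    exact ContinuousAffineMap.contDiff _
  have : riemannianEDist I ((extChartAt I x).symm a) ((extChartAt I x).symm b) ≤
      pathELength I γ 0 1 := by
    apply riemannianEDist_le_pathELength _ _ _ zero_le_one
    · exact (contMDiffOn_extChartAt_symm x).comp η_smooth hη.1
    · simp [γ, η, ContinuousAffineMap.coe_lineMap_eq]
    · simp [γ, η, ContinuousAffineMap.coe_lineMap_eq]
  apply this.trans
  rw [← lintegral_fderiv_lineMap_eq_edist, pathELength_eq_lintegral_mfderivWithin_Icc,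
    ← lintegral_const_mul' _ _ ENNReal.coe_ne_top]
  apply setLIntegral_mono' measurableSet_Icc (fun t ht ↦ ?_)
  have : mfderiv[Icc 0 1] γ t =
      (mfderiv[range I] (extChartAt I x).symm (η t)) ∘L (mfderiv[Icc 0 1] η t) := by
    apply mfderivWithin_comp
    · exact mdifferentiableWithinAt_extChartAt_symm (hη.1 ht)
    · exact η_smooth.mdifferentiableOn one_ne_zero t ht
    · exact hη.1.trans (preimage_mono (extChartAt_target_subset_range x))
    · rw [uniqueMDiffWithinAt_iff_uniqueDiffWithinAt]
      exact uniqueDiffOn_Icc zero_lt_one t ht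
  have : mfderiv[Icc 0 1] γ t 1 =
      (mfderiv[range I] (extChartAt I x).symm (η t)) (mfderiv[Icc 0 1] η t 1) := congr($this 1)
  rw [this]
  refine (hη.2 ht _).trans_eq ?_
  simp only [mfderivWithin_eq_fderivWithin]
  rfl

omit [IsContinuousRiemannianBundle E (fun x : M => TangentSpace I x)] in
/-- If the derivative of the extended chart is bounded by `C` along a `C¹` path, then the chart
expands the distance of the endpoints of the path by at most `C`. -/
theorem edist_extChartAt_le_pathELength {x : M} {C : ℝ≥0} {γ : ℝ → M} (hγ : CMDiff 1 γ)
    (hs : ∀ t ∈ Icc (0 : ℝ) 1, γ t ∈ (chartAt H x).source)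
    (hC : ∀ t ∈ Icc (0 : ℝ) 1, ∀ v : TangentSpace I (γ t),
      ‖(id (mfderiv I 𝓘(ℝ, E) (extChartAt I x) (γ t) v) : E)‖ₑ ≤ C * ‖v‖ₑ) :
    edist (extChartAt I x (γ 0)) (extChartAt I x (γ 1)) ≤ C * pathELength I γ 0 1 := by
  let γ' := extChartAt I x ∘ γ
  have hγ' : CMDiff[Icc 0 1] 1 γ' :=
    contMDiffOn_extChartAt.comp (I' := I) (t := (chartAt H x).source) hγ.contMDiffOn hs
  calc
    edist (extChartAt I x (γ 0)) (extChartAt I x (γ 1))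
    _ = ‖γ' 1 - γ' 0‖ₑ := by rw [edist_comm, edist_eq_enorm_sub]; rfl
    _ ≤ ∫⁻ t in Icc 0 1, ‖derivWithin γ' (Icc 0 1) t‖ₑ := by
      apply enorm_sub_le_lintegral_derivWithin_Icc_of_contDiffOn_Icc _ zero_le_one
      rwa [← contMDiffOn_iff_contDiffOn]
    _ = ∫⁻ t in Icc 0 1, ‖(id (mfderivWithin 𝓘(ℝ, ℝ) 𝓘(ℝ, E) γ' (Icc 0 1) t (1 : ℝ)) : E)‖ₑ := by
      simp_rw [← fderivWithin_derivWithin, mfderivWithin_eq_fderivWithin]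
      rfl
    _ ≤ ∫⁻ t in Icc 0 1, C * ‖mfderiv[Icc 0 1] γ t 1‖ₑ := by
      apply setLIntegral_mono' measurableSet_Icc (fun t ht ↦ ?_)
      have : mfderiv[Icc 0 1] γ' t =
          (mfderiv% (extChartAt I x) (γ t)) ∘L (mfderiv[Icc 0 1] γ t) := by
        apply mfderiv_comp_mfderivWithin
        · exact mdifferentiableAt_extChartAt (hs t ht)
        · exact (hγ.mdifferentiable one_ne_zero).mdifferentiableOn _ ht
        · rw [uniqueMDiffWithinAt_iff_uniqueDiffWithinAt]
          exact uniqueDiffOn_Icc zero_lt_one _ ht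
      have : mfderiv[Icc 0 1] γ' t 1 =
          (mfderiv% (extChartAt I x) (γ t)) (mfderiv[Icc 0 1] γ t 1) :=
        congr($this 1)
      exact (congrArg (fun w : E => ‖w‖ₑ) this).le.trans (hC t ht _)
    _ = C * pathELength I γ 0 1 := by
      rw [lintegral_const_mul' _ _ ENNReal.coe_ne_top,
          pathELength_eq_lintegral_mfderivWithin_Icc]

/-- The extended chart at `x` is Lipschitz near `x`. -/
theorem exists_edist_extChartAt_le [RegularSpace M] (x : M) :
    ∃ C > (0 : ℝ≥0), ∃ u ∈ 𝓝 x, u ⊆ (extChartAt I x).source ∧ ∀ y ∈ u, ∀ z ∈ u,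
      edist (extChartAt I x y) (extChartAt I x z) ≤ C * riemannianEDist I y z := by
  obtain ⟨C, C_pos, hC⟩ := eventually_enorm_mfderiv_extChartAt_apply_le I x
  obtain ⟨c, c_pos, hc⟩ := setOfPred_riemannianEDist_lt_subset_nhds I
    (inter_mem hC (extChartAt_source_mem_nhds (I := I) x))
  -- Points within `c / 4` of `x` are less than `c / 2` apart, and a path of length less than `c /
  -- 2` starting at one of them stays within `c` of `x`, where the derivative bound holds.
  have hc4 : (0 : ℝ≥0∞) < (c / 4 : ℝ≥0) := by exact_mod_cast (by positivity : 0 < c / 4)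
  have hsum : ((c / 4 : ℝ≥0) : ℝ≥0∞) + (c / 4 : ℝ≥0) = (c / 2 : ℝ≥0) := by
    rw [← ENNReal.coe_add]; congr 1; ring
  have hle : ((c / 4 : ℝ≥0) : ℝ≥0∞) + (c / 2 : ℝ≥0) ≤ c := by
    rw [← ENNReal.coe_add, ENNReal.coe_le_coe, ← NNReal.coe_le_coe]
    push_cast
    linarith [c.coe_nonneg]
  refine ⟨C, C_pos, {y | riemannianEDist I x y < (c / 4 : ℝ≥0)},
    eventually_riemannianEDist_lt I x hc4, fun y hy => (hc (lt_of_lt_of_le (mem_ofPred_eq.mp hy) ?_ : riemannianEDist I x y < c)).2,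
    fun y hy z hz => ?_⟩
  · exact le_trans le_self_add hle
  have hyz : riemannianEDist I y z < (c / 2 : ℝ≥0) := by
    refine (riemannianEDist_triangle (y := x)).trans_lt ?_
    rw [← hsum, riemannianEDist_comm]
    exact ENNReal.add_lt_add hy hz
  have key : ∀ r : ℝ≥0∞, riemannianEDist I y z < r → r ≤ (c / 2 : ℝ≥0) →
      edist (extChartAt I x y) (extChartAt I x z) ≤ C * r := by
    intro r hr hrc
    obtain ⟨γ, rfl, rfl, hγ, hlen, -⟩ :=
      exists_lt_locally_constant_of_riemannianEDist_lt hr zero_lt_one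
    have mem : ∀ t ∈ Icc (0 : ℝ) 1, riemannianEDist I x (γ t) < c := by
      intro t ht
      refine lt_of_lt_of_le ?_ hle
      refine (riemannianEDist_triangle (y := γ 0)).trans_lt (ENNReal.add_lt_add hy ?_)
      calc riemannianEDist I (γ 0) (γ t) ≤ pathELength I γ 0 t :=
            riemannianEDist_le_pathELength hγ.contMDiffOn rfl rfl ht.1
        _ ≤ pathELength I γ 0 1 := pathELength_mono le_rfl ht.2
        _ < _ := hlen.trans_le hrc
    refine (edist_extChartAt_le_pathELength I hγ (fun t ht => ?_)
      (fun t ht => (hc (mem t ht)).1)).trans (by gcongr)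
    simpa using (hc (mem t ht)).2
  have hC0 : (C : ℝ≥0∞) ≠ 0 := by exact_mod_cast C_pos.ne'
  rw [mul_comm, ← ENNReal.div_le_iff hC0 ENNReal.coe_ne_top]
  -- The distance is an infimum of path lengths, so any larger `r` suffices; capping it at `c / 2`
  -- keeps the path in the good neighbourhood.
  refine le_of_forall_gt_imp_ge_of_dense fun r hr => ?_
  rw [ENNReal.div_le_iff hC0 ENNReal.coe_ne_top, mul_comm]
  exact (key (min r (c / 2 : ℝ≥0)) (lt_min hr hyz) (min_le_right _ _)).trans
    (by gcongr; exact min_le_left _ _)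

end Riemannian

/-! ### Scaling of the Hausdorff measure under Lipschitz maps, and volumes of Euclidean balls. -/

theorem LipschitzOnWith.euclideanHausdorffMeasure_image_le {X Y : Type*} [EMetricSpace X]
    [MeasurableSpace X] [BorelSpace X] [EMetricSpace Y] [MeasurableSpace Y] [BorelSpace Y]
    {K : ℝ≥0} {f : X → Y} {s : Set X} (h : LipschitzOnWith K f s) (d : ℕ) :
    μHE[d] (f '' s) ≤ (K : ℝ≥0∞) ^ d * μHE[d] s := by
  have := h.hausdorffMeasure_image_le (d := d) (Nat.cast_nonneg d)
  rw [ENNReal.rpow_natCast] at this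
  simp only [Measure.euclideanHausdorffMeasure_def, Measure.smul_apply, ENNReal.smul_def,
    smul_eq_mul]
  rw [mul_left_comm]
  gcongr

theorem EuclideanSpace.volume_eball {d : ℕ} (z : EuclideanSpace ℝ (Fin d)) {ρ : ℝ≥0} (hρ : 0 < ρ) :
    volume (Metric.eball z ρ) =
      (ρ : ℝ≥0∞) ^ d * volume (Metric.ball (0 : EuclideanSpace ℝ (Fin d)) 1) := by
  rw [Metric.eball_coe, Measure.addHaar_ball_of_pos _ _ (by exact_mod_cast hρ),
    finrank_euclideanSpace_fin, ENNReal.ofReal_pow ρ.coe_nonneg, ENNReal.ofReal_coe_nnreal]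

/-! ### Ahlfors regularity of the Riemannian volume. -/

section Regularity

variable {d : ℕ} {M : Type*} [EMetricSpace M] [ChartedSpace (EuclideanSpace ℝ (Fin d)) M]
    [IsManifold (𝓡 d) ∞ M]
    [Bundle.RiemannianBundle (fun x : M => TangentSpace (𝓡 d) x)]
    [IsContMDiffRiemannianBundle (𝓡 d) ∞ (EuclideanSpace ℝ (Fin d))
      (fun x : M => TangentSpace (𝓡 d) x)]
    [IsRiemannianManifold (𝓡 d) M]

/-- Around each point of a Riemannian manifold there is a bi-Lipschitz chart. -/
theorem exists_bilipschitz_chart (x : M) :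
    ∃ (φ : M → EuclideanSpace ℝ (Fin d)) (ψ : EuclideanSpace ℝ (Fin d) → M)
      (B : Set (EuclideanSpace ℝ (Fin d))) (C δ : ℝ≥0),
      0 < C ∧ 0 < δ ∧ LipschitzOnWith C φ (Metric.eball x (2 * δ)) ∧ LipschitzOnWith C ψ B ∧
      (∀ y ∈ Metric.eball x (2 * δ), ψ (φ y) = y) ∧ (∀ b ∈ B, φ (ψ b) = b) ∧
      ∀ y ∈ Metric.eball x (2 * δ), Metric.eball (φ y) (δ / C) ⊆ B := by
  have : IsManifold (𝓡 d) 1 M := IsManifold.of_le (n := ∞) (by simp)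
  have : IsContinuousRiemannianBundle (EuclideanSpace ℝ (Fin d))
    (fun x : M => TangentSpace (𝓡 d) x) := by
    obtain ⟨g, hg, hg'⟩ := IsContMDiffRiemannianBundle.exists_contMDiff (IB := 𝓡 d) (n := ∞)
      (F := EuclideanSpace ℝ (Fin d)) (E := fun x : M => TangentSpace (𝓡 d) x)
    exact ⟨g, hg.continuous, hg'⟩
  obtain ⟨C₁, hC₁, r, hr, hrt, h₁⟩ := exists_riemannianEDist_extChartAt_symm_le (𝓡 d) x
  obtain ⟨C₂, hC₂, u, hu, hus, h₂⟩ := exists_edist_extChartAt_le (𝓡 d) x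
  simp only [ModelWithCorners.range_eq_univ, inter_univ] at hrt h₁
  set φ := extChartAt (𝓡 d) x
  have hN : u ∩ φ ⁻¹' (Metric.ball (φ x) (r / 2)) ∈ 𝓝 x :=
    inter_mem hu ((continuousAt_extChartAt x).preimage_mem_nhds
      (Metric.ball_mem_nhds _ (half_pos hr)))
  obtain ⟨ε, hε, hεN⟩ := EMetric.mem_nhds_iff.1 hN
  obtain ⟨ε', hε', hε'ε⟩ := ENNReal.lt_iff_exists_nnreal_btwn.1 hε
  set C := max C₁ C₂
  have hC : 0 < C := lt_max_of_lt_left hC₁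
  lift r to ℝ≥0 using hr.le
  have hr' : 0 < r := by exact_mod_cast hr
  have hε'' : 0 < ε' := by exact_mod_cast hε'
  -- The first bound puts the ball of radius `2 * δ` in the neighbourhood where `φ` is Lipschitz;
  -- the second gives `δ / C ≤ r / 2`, so that balls of radius `δ / C` about image points stay in
  -- the ball of radius `r`.
  set δ : ℝ≥0 := min (ε' / 2) (C * (r / 2))
  have hδ : 0 < δ := lt_min (by positivity) (by positivity)
  have hδN : Metric.eball x (2 * δ) ⊆ u ∩ φ ⁻¹' (Metric.ball (φ x) (r / 2)) := by
    refine (Metric.eball_subset_eball ?_).trans hεN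
    refine le_trans ?_ hε'ε.le
    norm_cast
    calc 2 * δ ≤ 2 * (ε' / 2) := by gcongr; exact min_le_left _ _
      _ = ε' := by field_simp
  refine ⟨φ, φ.symm, Metric.ball (φ x) r, C, δ, hC, hδ, ?_, ?_, ?_, ?_, ?_⟩
  · intro y hy z hz
    rw [IsRiemannianManifold.out (I := 𝓡 d) y z]
    refine (h₂ y (hδN hy).1 z (hδN hz).1).trans ?_
    gcongr
    exact le_max_right _ _
  · intro a ha b hb
    rw [IsRiemannianManifold.out (I := 𝓡 d)]
    refine (h₁ a ha b hb).trans ?_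
    gcongr
    exact le_max_left _ _
  · exact fun y hy => φ.left_inv (hus (hδN hy).1)
  · exact fun b hb => φ.right_inv (hrt hb)
  · intro y hy b hb
    have h1 : edist b (φ y) < (r / 2 : ℝ≥0) := by
      refine lt_of_lt_of_le hb ?_
      rw [← ENNReal.coe_div hC.ne', ENNReal.coe_le_coe, div_le_iff₀ hC, mul_comm]
      exact min_le_right _ _
    have h2 : dist (φ y) (φ x) < r / 2 := (hδN hy).2
    have h3 : dist b (φ y) < r / 2 := by
      rw [edist_nndist, ENNReal.coe_lt_coe] at h1
      exact_mod_cast h1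
    rw [Metric.mem_ball]
    linarith [dist_triangle b (φ y) (φ x)]

variable [MeasurableSpace M] [BorelSpace M]

/-- The `d`-dimensional Hausdorff measure of a `d`-dimensional Riemannian manifold is locally
Ahlfors regular. -/
theorem exists_measure_eball_le_le (x : M) :
    ∃ K δ : ℝ≥0, 0 < δ ∧ ∀ y ∈ Metric.eball x δ, ∀ ρ : ℝ≥0, 0 < ρ → ρ ≤ δ →
      (ρ : ℝ≥0∞) ^ d ≤ K * (μHE[d] : Measure M) (Metric.eball y ρ) ∧
      (μHE[d] : Measure M) (Metric.eball y ρ) ≤ K * (ρ : ℝ≥0∞) ^ d := by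
  obtain ⟨φ, ψ, B, C, δ, hC, hδ, hφ, hψ, hψφ, hφψ, hB⟩ := exists_bilipschitz_chart (d := d) x
  set w := (volume (Metric.ball (0 : EuclideanSpace ℝ (Fin d)) 1)).toNNReal
  have hw : (w : ℝ≥0∞) = volume (Metric.ball (0 : EuclideanSpace ℝ (Fin d)) 1) :=
    ENNReal.coe_toNNReal measure_ball_lt_top.ne
  have hw0 : 0 < w := by
    have : (0 : ℝ≥0∞) < w := by rw [hw]; exact Metric.measure_ball_pos _ _ one_pos
    exact_mod_cast this
  -- The first constant serves the upper bound, since `φ` maps the ball into a ball of radius `C *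
  -- ρ`; the second serves the lower bound, since the image contains a ball of radius `ρ / C`. Here
  -- `w` is the volume of the unit ball.
  refine ⟨max (C ^ d * (C ^ d * w)) (C ^ d * (C ^ d * w⁻¹)), δ, hδ, fun y hy ρ hρ hρδ => ?_⟩
  have hs : Metric.eball y ρ ⊆ Metric.eball x (2 * δ) := by
    intro z hz
    calc edist z x ≤ edist z y + edist y x := edist_triangle _ _ _
      _ < ρ + δ := ENNReal.add_lt_add hz hy
      _ ≤ 2 * δ := by rw [two_mul]; gcongr
  have hyy : y ∈ Metric.eball y (ρ : ℝ≥0∞) := Metric.mem_eball_self (by exact_mod_cast hρ)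
  have hC' : (C : ℝ≥0∞) ≠ 0 := by exact_mod_cast hC.ne'
  have hφs : φ '' Metric.eball y ρ ⊆ Metric.eball (φ y) (C * ρ : ℝ≥0) := by
    rintro _ ⟨z, hz, rfl⟩
    refine (hφ (hs hz) (hs hyy)).trans_lt ?_
    rw [ENNReal.coe_mul]
    exact ENNReal.mul_lt_mul_right hC' ENNReal.coe_ne_top hz
  have hsB : φ '' Metric.eball y ρ ⊆ B := by
    rintro _ ⟨z, hz, rfl⟩
    exact hB z (hs hz) (Metric.mem_eball_self
      (ENNReal.div_pos (by exact_mod_cast hδ.ne') ENNReal.coe_ne_top))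
  have hψs : ψ '' (φ '' Metric.eball y ρ) = Metric.eball y ρ := by
    rw [image_image]
    exact (image_congr fun z hz => hψφ z (hs hz)).trans (image_id' _)
  have hball : Metric.eball (φ y) (ρ / C : ℝ≥0) ⊆ φ '' Metric.eball y ρ := by
    intro b hb
    have hbB : b ∈ B := by
      refine hB y (hs hyy) (lt_of_lt_of_le (b := ((ρ / C : ℝ≥0) : ℝ≥0∞)) hb ?_)
      rw [ENNReal.coe_div hC.ne']
      gcongr
    refine ⟨ψ b, ?_, hφψ b hbB⟩
    have := hψ hbB (hsB ⟨y, hyy, rfl⟩)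
    rw [hψφ y (hs hyy)] at this
    refine this.trans_lt ?_
    calc (C : ℝ≥0∞) * edist b (φ y) < C * (ρ / C : ℝ≥0) :=
          ENNReal.mul_lt_mul_right hC' ENNReal.coe_ne_top hb
      _ = ρ := by rw [← ENNReal.coe_mul]; congr 1; field_simp
  constructor
  · have h1 := (measure_mono hball).trans
      ((hφ.mono hs).euclideanHausdorffMeasure_image_le d)
    rw [EuclideanSpace.euclideanHausdorffMeasure_eq_volume,
      EuclideanSpace.volume_eball _ (by positivity), ← hw] at h1
    calc (ρ : ℝ≥0∞) ^ d = (C ^ d * w⁻¹ : ℝ≥0) * (((ρ / C : ℝ≥0) : ℝ≥0∞) ^ d * w) := by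
          norm_cast; rw [div_pow]; field_simp
      _ ≤ (C ^ d * w⁻¹ : ℝ≥0) * (C ^ d * (μHE[d] : Measure M) (Metric.eball y ρ)) := by gcongr
      _ = (C ^ d * (C ^ d * w⁻¹) : ℝ≥0) * (μHE[d] : Measure M) (Metric.eball y ρ) := by
          push_cast; ring
      _ ≤ _ := by gcongr; exact le_max_right _ _
  · have h1 := (hψ.mono hsB).euclideanHausdorffMeasure_image_le d
    rw [hψs, EuclideanSpace.euclideanHausdorffMeasure_eq_volume] at h1
    calc (μHE[d] : Measure M) (Metric.eball y ρ)
        ≤ C ^ d * volume (Metric.eball (φ y) (C * ρ : ℝ≥0)) :=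
          h1.trans (by gcongr)
      _ = (C ^ d * (C ^ d * w) : ℝ≥0) * (ρ : ℝ≥0∞) ^ d := by
          rw [EuclideanSpace.volume_eball _ (by positivity), ← hw]
          push_cast; ring
      _ ≤ _ := by gcongr; exact le_max_left _ _

variable [CompactSpace M]

/-- The `d`-dimensional Hausdorff measure of a compact `d`-dimensional Riemannian manifold is
Ahlfors regular. -/
theorem exists_forall_measure_eball_le_le :
    ∃ K δ : ℝ≥0, 0 < δ ∧ ∀ (y : M) (ρ : ℝ≥0), 0 < ρ → ρ ≤ δ →
      (ρ : ℝ≥0∞) ^ d ≤ K * (μHE[d] : Measure M) (Metric.eball y ρ) ∧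
      (μHE[d] : Measure M) (Metric.eball y ρ) ≤ K * (ρ : ℝ≥0∞) ^ d := by
  suffices ∃ K δ : ℝ≥0, 0 < δ ∧ ∀ y ∈ (univ : Set M), ∀ ρ : ℝ≥0, 0 < ρ → ρ ≤ δ →
      (ρ : ℝ≥0∞) ^ d ≤ K * (μHE[d] : Measure M) (Metric.eball y ρ) ∧
      (μHE[d] : Measure M) (Metric.eball y ρ) ≤ K * (ρ : ℝ≥0∞) ^ d by
    simpa using this
  -- Having uniform constants passes to subsets and finite unions and holds near each point.
  refine isCompact_univ.induction_on (p := fun s : Set M => ∃ K δ : ℝ≥0, 0 < δ ∧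
      ∀ y ∈ s, ∀ ρ : ℝ≥0, 0 < ρ → ρ ≤ δ →
      (ρ : ℝ≥0∞) ^ d ≤ K * (μHE[d] : Measure M) (Metric.eball y ρ) ∧
      (μHE[d] : Measure M) (Metric.eball y ρ) ≤ K * (ρ : ℝ≥0∞) ^ d) ?_ ?_ ?_ ?_
  · exact ⟨0, 1, one_pos, by simp⟩
  · rintro s t hst ⟨K, δ, hδ, h⟩
    exact ⟨K, δ, hδ, fun y hy => h y (hst hy)⟩
  · rintro s t ⟨K, δ, hδ, h⟩ ⟨K', δ', hδ', h'⟩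
    refine ⟨max K K', min δ δ', lt_min hδ hδ', ?_⟩
    rintro y (hy | hy) ρ hρ hρδ
    · obtain ⟨h1, h2⟩ := h y hy ρ hρ (hρδ.trans (min_le_left _ _))
      have hK : (K : ℝ≥0∞) ≤ (max K K' : ℝ≥0) := by exact_mod_cast le_max_left _ _
      exact ⟨h1.trans (by gcongr), h2.trans (by gcongr)⟩
    · obtain ⟨h1, h2⟩ := h' y hy ρ hρ (hρδ.trans (min_le_right _ _))
      have hK : (K' : ℝ≥0∞) ≤ (max K K' : ℝ≥0) := by exact_mod_cast le_max_right _ _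
      exact ⟨h1.trans (by gcongr), h2.trans (by gcongr)⟩
  · intro x _
    obtain ⟨K, δ, hδ, h⟩ := exists_measure_eball_le_le (d := d) x
    exact ⟨Metric.eball x δ, mem_nhdsWithin_of_mem_nhds
      (Metric.eball_mem_nhds x (by exact_mod_cast hδ)), K, δ, hδ, h⟩

variable (d M) in
theorem euclideanHausdorffMeasure_univ_lt_top : (μHE[d] : Measure M) univ < ⊤ := by
  obtain ⟨K, δ, hδ, h⟩ := exists_forall_measure_eball_le_le (d := d) (M := M)
  refine isCompact_univ.measure_lt_top_of_nhdsWithin fun x _ => ?_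
  refine ⟨Metric.eball x δ, mem_nhdsWithin_of_mem_nhds
      (Metric.eball_mem_nhds x (by exact_mod_cast hδ)), ?_⟩
  refine (h x δ hδ le_rfl).2.trans_lt ?_
  norm_cast
  exact ENNReal.coe_lt_top

variable (d M) in
theorem euclideanHausdorffMeasure_univ_ne_zero [Nonempty M] : (μHE[d] : Measure M) univ ≠ 0 := by
  obtain ⟨K, δ, hδ, h⟩ := exists_forall_measure_eball_le_le (d := d) (M := M)
  intro h0
  have h1 := (h (Classical.arbitrary M) δ hδ le_rfl).1
  rw [measure_mono_null (subset_univ _) h0, mul_zero, nonpos_iff_eq_zero] at h1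
  exact pow_ne_zero d (by exact_mod_cast hδ.ne') h1

variable (d M) in
theorem isProbabilityMeasure_normalizedVolume [Nonempty M] :
    IsProbabilityMeasure (normalizedVolume d M) := by
  refine ⟨?_⟩
  rw [normalizedVolume, Measure.smul_apply, smul_eq_mul]
  exact ENNReal.inv_mul_cancel (euclideanHausdorffMeasure_univ_ne_zero d M)
    (euclideanHausdorffMeasure_univ_lt_top d M).ne

omit [IsManifold (𝓡 d) ∞ M] [Bundle.RiemannianBundle (fun x : M => TangentSpace (𝓡 d) x)]
  [IsContMDiffRiemannianBundle (𝓡 d) ∞ (EuclideanSpace ℝ (Fin d))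
      (fun x : M => TangentSpace (𝓡 d) x)] [IsRiemannianManifold (𝓡 d) M] [CompactSpace M]
  [ChartedSpace (EuclideanSpace ℝ (Fin d)) M] in
-- Positive dimension enters here; with total mass one it makes `M` infinite.
theorem normalizedVolume_singleton (hd : 0 < d) (x : M) : normalizedVolume d M {x} = 0 := by
  have := Measure.nullSingletonClass_hausdorff M (d := d) (by exact_mod_cast hd)
  simp [normalizedVolume, Measure.euclideanHausdorffMeasure_def]

variable (d M) in
/-- The volumes of balls of comparable radii in a compact Riemannian manifold are comparable. -/
theorem exists_normalizedVolume_eball_le :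
    ∃ Q : ℝ≥0, ∀ (y y' : M) (ρ : ℝ≥0), 0 < ρ →
      normalizedVolume d M (Metric.eball y (5 * ρ)) ≤
        Q * normalizedVolume d M (Metric.eball y' ρ) := by
  obtain ⟨K, δ, hδ, h⟩ := exists_forall_measure_eball_le_le (d := d) (M := M)
  set T := ((μHE[d] : Measure M) univ).toNNReal
  have hT : (T : ℝ≥0∞) = (μHE[d] : Measure M) univ :=
    ENNReal.coe_toNNReal (euclideanHausdorffMeasure_univ_lt_top d M).ne
  refine ⟨max (K * 5 ^ d * K) (T * (δ / 5)⁻¹ ^ d * K), fun y y' ρ hρ => ?_⟩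
  simp only [normalizedVolume, Measure.smul_apply, smul_eq_mul]
  rw [mul_left_comm]
  gcongr
  -- At small scales both balls are controlled by regularity. At large scales the total mass bounds
  -- the big ball, and the small one contains a ball of radius `δ / 5`.
  rcases le_total (5 * ρ) δ with hle | hle
  · have h1 := (h y (5 * ρ) (by positivity) hle).2
    have h2 := (h y' ρ hρ (le_trans (by
      calc ρ = 1 * ρ := (one_mul _).symm
        _ ≤ 5 * ρ := by gcongr; norm_num) hle)).1
    push_cast at h1
    calc _ ≤ K * (5 * (ρ : ℝ≥0∞)) ^ d := h1
      _ = K * 5 ^ d * ρ ^ d := by rw [mul_pow, mul_assoc]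
      _ ≤ K * 5 ^ d * (K * (μHE[d] : Measure M) (Metric.eball y' ρ)) := by gcongr
      _ = (K * 5 ^ d * K : ℝ≥0) * (μHE[d] : Measure M) (Metric.eball y' ρ) := by
        push_cast; ring
      _ ≤ _ := by gcongr; exact le_max_left _ _
  · have hδ5 : 0 < δ / 5 := by positivity
    have h2 := (h y' (δ / 5) hδ5 (div_le_self hδ.le (by norm_num))).1
    have hρδ : δ / 5 ≤ ρ := by rw [div_le_iff₀' (by norm_num)]; exact hle
    calc _ ≤ (T : ℝ≥0∞) := by rw [hT]; exact measure_mono (subset_univ _)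
      _ = (T * (δ / 5)⁻¹ ^ d : ℝ≥0) * ((δ / 5 : ℝ≥0) : ℝ≥0∞) ^ d := by
        norm_cast; rw [inv_pow, mul_assoc, inv_mul_cancel₀ (by positivity), mul_one]
      _ ≤ (T * (δ / 5)⁻¹ ^ d : ℝ≥0) * (K * (μHE[d] : Measure M) (Metric.eball y' ρ)) := by
        refine mul_le_mul_right (h2.trans ?_) _
        gcongr
      _ = (T * (δ / 5)⁻¹ ^ d * K : ℝ≥0) * (μHE[d] : Measure M) (Metric.eball y' ρ) := by
        push_cast; ring
      _ ≤ _ := by gcongr; exact le_max_right _ _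

end Regularity

/-! ### Consequences of a Poincaré inequality on a finite graph. -/

section Graph

open Classical in
/-- The `E`-valued Poincaré inequality with constant `K` on a finite graph. -/
def HasPoincareInequality {V : Type*} [Fintype V] (G : SimpleGraph V) (E : Type*)
    [NormedAddCommGroup E] (K : ℝ≥0) : Prop :=
  ∀ f : V → E, ∃ m : E,
    ∑ v, ‖f v - m‖ ^ 2 ≤ K * ∑ v, ∑ w, if G.Adj v w then ‖f v - f w‖ ^ 2 else 0

namespace HasPoincareInequality

variable {V : Type*} [Fintype V] {G : SimpleGraph V} {E : Type*} [NormedAddCommGroup E]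
  [NormedSpace ℝ E] {K : ℝ≥0}

open Classical in
omit [NormedSpace ℝ E] in
-- A term is non-zero only if exactly one end of the edge lies in `A`, and then it is `1`. Each
-- boundary edge occurs as two ordered pairs, whence the factor `2`.
theorem sum_adj_indicator_le (A : Finset V) {e : E} (he : ‖e‖ = 1) :
    (∑ v, ∑ w, if G.Adj v w then
      ‖(if v ∈ A then e else 0) - (if w ∈ A then e else 0)‖ ^ 2 else 0) ≤
      2 * edgeBoundaryCard G A := by
  have hT : ∑ v, ∑ w, (if G.Adj v w ∧ v ∈ A ∧ w ∉ A then (1 : ℝ) else 0) ≤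
      edgeBoundaryCard G A := by
    rw [← Fintype.sum_prod_type' (f := fun v w => if G.Adj v w ∧ v ∈ A ∧ w ∉ A then (1 : ℝ) else 0),
      ← Finset.sum_filter, Finset.sum_const, nsmul_eq_mul, mul_one]
    norm_cast
    rw [← Set.ncard_coe_finset, edgeBoundaryCard]
    refine Set.ncard_le_ncard_of_injOn (fun p => s(p.1, p.2)) ?_ ?_ (Set.toFinite _)
    · rintro ⟨v, w⟩ h
      simp only [Finset.coe_filter, Finset.mem_univ, true_and, mem_ofPred_eq] at h
      exact ⟨h.1, v, h.2.1, w, h.2.2, rfl⟩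
    · rintro ⟨v, w⟩ h ⟨v', w'⟩ h' heq
      simp only [Finset.coe_filter, Finset.mem_univ, true_and, mem_ofPred_eq] at h h'
      rcases Sym2.eq_iff.1 heq with ⟨rfl, rfl⟩ | ⟨rfl, rfl⟩
      · rfl
      · exact absurd h.2.1 h'.2.2
  have hT' : ∑ v, ∑ w, (if G.Adj v w ∧ w ∈ A ∧ v ∉ A then (1 : ℝ) else 0) ≤
      edgeBoundaryCard G A := by
    rw [Finset.sum_comm]
    simpa only [G.adj_comm] using hT
  refine le_trans ?_ ((add_le_add hT hT').trans_eq (two_mul _).symm)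
  simp only [← Finset.sum_add_distrib]
  gcongr with v _ w _
  by_cases h : G.Adj v w <;> by_cases hv : v ∈ A <;> by_cases hw : w ∈ A <;> simp [h, hv, hw, he]

/-- The inequality is tested on the indicator of `A` times a unit vector `e`. No `m` is close to
both `e` and `0`: `‖e - m‖² + ‖m‖² ≥ 1/2`. As the complement is at least as large as `A`, the left
side is at least `|A| / 2`; with the two orientations of an edge this gives the factor `4`. -/
theorem card_le [Nontrivial E] (h : HasPoincareInequality G E K) (A : Finset V)
    (hA : 2 * A.card ≤ Nat.card V) : (A.card : ℝ) ≤ 4 * K * edgeBoundaryCard G A := by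
  classical
  obtain ⟨e, he⟩ := exists_norm_eq E zero_le_one
  obtain ⟨m, hm⟩ := h fun v => if v ∈ A then e else 0
  have h1 := hm.trans (mul_le_mul_of_nonneg_left
    (sum_adj_indicator_le (G := G) A he) K.coe_nonneg)
  rw [Nat.card_eq_fintype_card] at hA
  have hc : (A.card : ℝ) ≤ Aᶜ.card := by
    rw [Finset.card_compl]
    exact_mod_cast (by omega : A.card ≤ Fintype.card V - A.card)
  have h2 : A.card * ‖e - m‖ ^ 2 + Aᶜ.card * ‖m‖ ^ 2 =
      ∑ v, ‖(if v ∈ A then e else 0) - m‖ ^ 2 := by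
    rw [← Finset.sum_add_sum_compl A]
    congr 1
    · rw [Finset.sum_congr rfl (g := fun _ => ‖e - m‖ ^ 2) (fun v hv => by simp [hv])]
      simp
    · rw [Finset.sum_congr rfl (g := fun _ => ‖m‖ ^ 2) (fun v hv => by
        simp [Finset.mem_compl.1 hv])]
      simp
  have h3 : 1 ≤ ‖e - m‖ + ‖m‖ := by
    calc 1 = ‖(e - m) + m‖ := by rw [sub_add_cancel, he]
      _ ≤ _ := norm_add_le _ _
  have h4 : (1 : ℝ) / 2 ≤ ‖e - m‖ ^ 2 + ‖m‖ ^ 2 := by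
    nlinarith [sq_nonneg (‖e - m‖ - ‖m‖), norm_nonneg (e - m), norm_nonneg m]
  have h5 : (A.card : ℝ) * (1 / 2) ≤ A.card * ‖e - m‖ ^ 2 + Aᶜ.card * ‖m‖ ^ 2 := by
    calc (A.card : ℝ) * (1 / 2) ≤ A.card * (‖e - m‖ ^ 2 + ‖m‖ ^ 2) := by gcongr
      _ = A.card * ‖e - m‖ ^ 2 + A.card * ‖m‖ ^ 2 := mul_add _ _ _
      _ ≤ _ := by gcongr
  linarith

theorem le_cheegerConstant [Nontrivial E] (h : HasPoincareInequality G E K) (hK : 0 < K) :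
    ((1 / (4 * K) : ℝ≥0) : ℝ≥0∞) ≤ cheegerConstant G := by
  refine le_iInf₂ fun A hA => ?_
  have hA0 : A.card ≠ 0 := hA.1.card_pos.ne'
  rw [ENNReal.le_div_iff_mul_le (Or.inl (by exact_mod_cast hA0))
    (Or.inl (ENNReal.natCast_ne_top _))]
  have h1 := h.card_le A hA.2
  have h2 : (A.card : ℝ≥0) ≤ 4 * K * edgeBoundaryCard G A := by exact_mod_cast h1
  norm_cast
  rw [one_div_mul_eq_div, div_le_iff₀ (by positivity), mul_comm]
  exact h2

/-- By `card_le`, a set without boundary edges that has at most half of the vertices is empty. A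
component and its complement have no boundary edges and one of them has at most half of the
vertices, so the complement is empty. -/
theorem connected [Nontrivial E] [Nonempty V] (h : HasPoincareInequality G E K) :
    G.Connected := by
  classical
  refine ⟨fun v w => ?_⟩
  have key : ∀ A : Finset V, (∀ a ∈ A, ∀ b, G.Adj a b → b ∈ A) → 2 * A.card ≤ Nat.card V →
      A = ∅ := by
    intro A hA hcard
    have h0 : edgeBoundaryCard G A = 0 := by
      rw [edgeBoundaryCard, Set.ncard_eq_zero (Set.toFinite _), Set.eq_empty_iff_forall_notMem]
      rintro _ ⟨hadj, a, ha, b, hb, rfl⟩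
      exact hb (hA a ha b hadj)
    have := h.card_le A hcard
    rw [h0] at this
    simpa using this
  set A : Finset V := Finset.univ.filter fun w => G.Reachable v w
  have hA : A ≠ ∅ := Finset.ne_empty_of_mem (a := v) (by simp [A])
  have h1 : ¬ 2 * A.card ≤ Nat.card V := fun hc => hA <| key A (fun a ha b hab => by
    simp only [A, Finset.mem_filter, Finset.mem_univ, true_and] at ha ⊢
    exact ha.trans hab.reachable) hc
  have h2 : Aᶜ = ∅ := by
    refine key _ (fun a ha b hab => ?_) ?_
    · simp only [A, Finset.mem_compl, Finset.mem_filter, Finset.mem_univ, true_and] at ha ⊢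
      exact fun hb => ha (hb.trans hab.symm.reachable)
    · rw [Finset.card_compl]
      rw [Nat.card_eq_fintype_card] at h1 ⊢
      omega
  have h3 : w ∈ A := by simpa using (Finset.eq_empty_iff_forall_notMem.1 h2 w)
  simpa [A] using h3

end HasPoincareInequality

/-- In a graph with degrees at most `D`, the ball of radius `r` has at most `(D + 1) ^ r`
vertices. -/
theorem DegreeBoundedBy.exists_finset_forall_walk {V : Type*} {G : SimpleGraph V} {D : ℕ}
    (hG : DegreeBoundedBy G D) (v : V) (r : ℕ) :
    ∃ N : Finset V, N.card ≤ (D + 1) ^ r ∧ ∀ (w : V) (p : G.Walk w v), p.length ≤ r → w ∈ N := by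
  classical
  induction r with
  | zero =>
    refine ⟨{v}, by simp, fun w p hp => ?_⟩
    simpa using SimpleGraph.Walk.eq_of_length_eq_zero (Nat.le_zero.1 hp)
  | succ r ih =>
    obtain ⟨N, hN, h⟩ := ih
    -- Walks end at `v`, so removing the first edge leaves a shorter walk to `v` from a neighbour of
    -- `w`; the inserted `u` accounts for the `+ 1`.
    refine ⟨N.biUnion fun u => insert u (hG u).1.toFinset, ?_, fun w p hp => ?_⟩
    · refine (Finset.card_biUnion_le_card_mul _ _ (D + 1) fun u _ => ?_).trans ?_
      · refine (Finset.card_insert_le _ _).trans ?_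
        rw [← Set.ncard_eq_toFinset_card _ (hG u).1]
        exact Nat.add_le_add_right (hG u).2 1
      · rw [pow_succ]
        exact Nat.mul_le_mul_right _ hN
    · rw [Finset.mem_biUnion]
      cases p with
      | nil => exact ⟨v, h v .nil (Nat.zero_le _), Finset.mem_insert_self _ _⟩
      | @cons _ u _ hadj p =>
        refine ⟨u, h u p ?_, Finset.mem_insert_of_mem ?_⟩
        · simpa using hp
        · simpa using hadj.symm

open Classical in
-- By a Chebyshev estimate at least half of the vertices are mapped to within `√(2 * S)` of `m`.
-- Their images are then less than `ρ₁ r` apart, so these vertices all lie in one graph ball of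
-- radius `r`.
theorem HasPoincareInequality.card_le_of_isCoarseEmbeddingWith {V : Type*} [Fintype V] [Nonempty V]
    {G : SimpleGraph V} {E : Type*} [NormedAddCommGroup E] {K : ℝ≥0} {D : ℕ}
    (h : HasPoincareInequality G E K) (hconn : G.Connected) (hD : DegreeBoundedBy G D)
    {ρ₁ ρ₂ : ℝ≥0 → ℝ≥0} (hρ₁ : Monotone ρ₁) {f : V → E}
    (hf : IsCoarseEmbeddingWith G ρ₁ ρ₂ f) {r : ℕ}
    (hr : 2 * √(2 * (K * (D * (ρ₂ 1 : ℝ) ^ 2) + 1)) < ρ₁ r) :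
    Fintype.card V ≤ 2 * (D + 1) ^ r := by
  set L : ℝ := NNReal.toReal (ρ₂ 1)
  -- The summand `1` makes `S` positive, so that it can be cancelled.
  set S : ℝ := K * (D * L ^ 2) + 1
  have hS : 0 < S := by positivity
  obtain ⟨m, hm⟩ := h f
  have hterm : ∀ v, (∑ w, if G.Adj v w then ‖f v - f w‖ ^ 2 else 0) ≤ D * L ^ 2 := by
    intro v
    rw [← Finset.sum_filter]
    have hcard : (Finset.univ.filter fun w => G.Adj v w).card ≤ D := by
      refine le_trans (le_of_eq ?_) (hD v).2
      rw [← Set.ncard_coe_finset]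
      congr 1
      ext; simp
    refine (Finset.sum_le_card_nsmul _ _ (L ^ 2) fun w hw => ?_).trans ?_
    · have hadj : G.Adj v w := by simpa using hw
      have h1 := (hf v w).2
      rw [SimpleGraph.dist_eq_one_iff_adj.2 hadj, Nat.cast_one] at h1
      have h2 : ‖f v - f w‖ ≤ L := by rw [← dist_eq_norm]; exact_mod_cast h1
      gcongr
    · rw [nsmul_eq_mul]
      gcongr
  have hsum : ∑ v, ‖f v - m‖ ^ 2 ≤ Fintype.card V * S := by
    refine hm.trans ?_
    calc K * ∑ v, ∑ w, (if G.Adj v w then ‖f v - f w‖ ^ 2 else 0)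
        ≤ K * ∑ v : V, D * L ^ 2 := by gcongr with v _; exact hterm v
      _ = Fintype.card V * (K * (D * L ^ 2)) := by
        rw [Finset.sum_const, nsmul_eq_mul, Finset.card_univ]; ring
      _ ≤ _ := by gcongr; simp [S]
  set B : Finset V := Finset.univ.filter fun v => ‖f v - m‖ ^ 2 ≤ 2 * S
  have hBc : (Bᶜ.card : ℝ) * (2 * S) ≤ Fintype.card V * S := by
    refine le_trans ?_ hsum
    refine le_trans ?_ (Finset.sum_le_sum_of_subset_of_nonneg (Finset.subset_univ Bᶜ)
      fun v _ _ => by positivity)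
    rw [← nsmul_eq_mul]
    refine Finset.card_nsmul_le_sum _ _ _ fun v hv => ?_
    simp only [B, Finset.mem_compl, Finset.mem_filter, Finset.mem_univ, true_and, not_le] at hv
    exact hv.le
  have hBc' : 2 * Bᶜ.card ≤ Fintype.card V := by
    have : (Bᶜ.card : ℝ) * 2 ≤ Fintype.card V := by
      refine le_of_mul_le_mul_right ?_ hS
      linarith
    rw [mul_comm]
    exact_mod_cast this
  have hB : Fintype.card V ≤ 2 * B.card := by
    have := B.card_add_card_compl
    omega
  have hBne : B.Nonempty := by
    rw [← Finset.card_pos]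
    have : 0 < Fintype.card V := Fintype.card_pos
    omega
  obtain ⟨v₀, hv₀⟩ := hBne
  obtain ⟨N, hN, hNw⟩ := hD.exists_finset_forall_walk v₀ r
  refine hB.trans (Nat.mul_le_mul_left 2 ((Finset.card_le_card fun w hw => ?_).trans hN))
  obtain ⟨p, hp⟩ := hconn.exists_walk_length_eq_dist w v₀
  refine hNw w p ?_
  rw [hp]
  by_contra! hlt
  have h1 : (ρ₁ r : ℝ) ≤ ‖f w - f v₀‖ := by
    rw [← dist_eq_norm]
    exact_mod_cast (hρ₁ (by exact_mod_cast hlt.le)).trans (hf w v₀).1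
  have hroot : ∀ v ∈ B, ‖f v - m‖ ≤ √(2 * S) := fun v hv =>
    Real.le_sqrt_of_sq_le (by simpa [B] using hv)
  have h2 : ‖f w - f v₀‖ ≤ ‖f w - m‖ + ‖f v₀ - m‖ := by
    simpa [dist_eq_norm] using dist_triangle_right (f w) (f v₀) m
  linarith [hroot w hw, hroot v₀ hv₀]

/-- Finite graphs with uniformly bounded degrees and a uniform `E`-valued Poincaré inequality, whose
numbers of vertices tend to infinity, form an expander that does not coarsely embed into `E`. -/
theorem isExpander_and_not_coarselyEmbeds {V : ℕ → Type*} [∀ n, Fintype (V n)]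
    [∀ n, Nonempty (V n)] {G : ∀ n, SimpleGraph (V n)} {E : Type*} [NormedAddCommGroup E]
    [NormedSpace ℝ E] [Nontrivial E] {K : ℝ≥0} (hK : 0 < K) {D : ℕ}
    (hD : ∀ n, DegreeBoundedBy (G n) D)
    (hcard : Tendsto (fun n => Nat.card (V n)) atTop atTop)
    (h : ∀ n, HasPoincareInequality (G n) E K) : IsExpander G ∧ ¬ CoarselyEmbeds G E := by
  refine ⟨⟨fun n => inferInstance, fun n => (h n).connected, ⟨D, hD⟩, hcard,
    1 / (4 * K), by positivity, fun n => (h n).le_cheegerConstant hK⟩, ?_⟩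
  rintro ⟨ρ₁, ρ₂, ⟨hρ₁, hρ₁'⟩, -, f, hf⟩
  -- The radius depends only on `K`, `D` and the control functions, not on `n`.
  obtain ⟨r, hr⟩ := hρ₁' (Real.toNNReal (2 * √(2 * (K * (D * (ρ₂ 1 : ℝ) ^ 2) + 1))))
  obtain ⟨k, hk⟩ := exists_nat_ge r
  have hr' := (Real.toNNReal_lt_iff_lt_coe (by positivity)).1 (hr.trans_le (hρ₁ hk))
  obtain ⟨n, hn⟩ := (hcard.eventually_gt_atTop (2 * (D + 1) ^ k)).exists
  rw [Nat.card_eq_fintype_card] at hn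
  exact absurd ((h n).card_le_of_isCoarseEmbeddingWith (h n).connected (hD n) hρ₁ (hf n) hr')
    (not_le.2 hn)

end Graph

/-! ### From the spectral gap to a Poincaré inequality on approximating graphs. -/

section Partition

variable {X : Type*}

namespace Finpartition

variable (P : Finpartition (univ : Set X))

theorem eq_of_mem_of_mem {R R' : {R : Set X // R ∈ P.parts}} {x : X} (h : x ∈ R.1)
    (h' : x ∈ R'.1) : R = R' := by
  by_contra hne
  exact Set.disjoint_left.1 (P.disjoint R.2 R'.2 fun h => hne (Subtype.ext h)) h h'

/-- The region of a finite partition of `X` that contains a point. -/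
theorem exists_region : ∃ p : X → {R : Set X // R ∈ P.parts}, ∀ x R, p x = R ↔ x ∈ R.1 := by
  have h : ∀ x : X, ∃ R : {R : Set X // R ∈ P.parts}, x ∈ R.1 := by
    intro x
    have hx : x ∈ P.parts.sup id := by rw [P.sup_parts]; exact mem_univ x
    rw [Finset.sup_id_set_eq_sUnion] at hx
    obtain ⟨R, hR, hxR⟩ := hx
    exact ⟨⟨R, hR⟩, hxR⟩
  choose p hp using h
  exact ⟨p, fun x R => ⟨fun h => h ▸ hp x, fun h => P.eq_of_mem_of_mem (hp x) h⟩⟩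

end Finpartition

theorem lintegral_comp_eq_sum [MeasurableSpace X] {V : Type*} [Fintype V] (ν : Measure X)
    {p : X → V} (hp : ∀ v, MeasurableSet (p ⁻¹' {v})) (g : V → ℝ≥0∞) :
    ∫⁻ x, g (p x) ∂ν = ∑ v, g v * ν (p ⁻¹' {v}) := by
  let : MeasurableSpace V := ⊤
  have hpm : Measurable p := measurable_to_countable' hp
  rw [← lintegral_map (measurable_from_top) hpm, lintegral_fintype]
  simp only [Measure.map_apply hpm (MeasurableSet.singleton _)]

theorem eLpNorm_two_pow_two [MeasurableSpace X] {E : Type*} [NormedAddCommGroup E] (ν : Measure X)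
    (f : X → E) : eLpNorm f 2 ν ^ 2 = ∫⁻ x, ‖f x‖ₑ ^ 2 ∂ν := by
  have := eLpNorm_nnreal_pow_eq_lintegral (f := f) (μ := ν) (p := 2) two_ne_zero
  simpa using this

variable [MeasurableSpace X] {ν : Measure X} {Γ : Type*} [Group Γ] [MulAction Γ X] {S : Finset Γ}
  {E : Type*} [NormedAddCommGroup E] [NormedSpace ℝ E]
  {P : Finpartition (univ : Set X)}

open Classical in
/-- The defining inequality of the spectral gap for functions that are constant on the regions of
a partition. -/
theorem sum_enorm_sub_sq_le [CompleteSpace E] [IsProbabilityMeasure ν]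
    (hS : ∀ s : Γ, Measurable fun x : X => s • x) (hP : IsMeasurablePartition P) {ε : ℝ≥0}
    (hε : ∀ f : X → E, MemLp f 2 ν → ∫ x, f x ∂ν = 0 →
      ∃ s ∈ S, (ε : ℝ≥0∞) * eLpNorm f 2 ν ≤ eLpNorm (fun x => f x - f (s⁻¹ • x)) 2 ν)
    (f : {R : Set X // R ∈ P.parts} → E) :
    ∃ m : E, (ε : ℝ≥0∞) ^ 2 * ∑ v, ‖f v - m‖ₑ ^ 2 * ν v.1 ≤
      ∑ v, ∑ w, (if (approxGraph S ν P).Adj v w then ‖f v - f w‖ₑ ^ 2 else 0) * ν v.1 := by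
  obtain ⟨p, hp⟩ := P.exists_region
  have hpv : ∀ v, p ⁻¹' {v} = v.1 := fun v => by ext x; simp [hp]
  have hpm : ∀ v, MeasurableSet (p ⁻¹' {v}) := fun v => by rw [hpv]; exact hP v.1 v.2
  let F : SimpleFunc X E := SimpleFunc.map f ⟨p, hpm, Set.toFinite _⟩
  have hF : ∀ x, F x = f (p x) := fun _ => rfl
  have hFm : MemLp F 2 ν := SimpleFunc.memLp_of_isFiniteMeasure _ _ _
  have hFi : Integrable F ν := hFm.integrable one_le_two
  set m : E := ∫ x, F x ∂ν
  obtain ⟨s, hs, h⟩ := hε (fun x => F x - m) (hFm.sub (memLp_const m))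
    (by rw [integral_sub hFi (integrable_const m)]; simp [m])
  refine ⟨m, ?_⟩
  have h2 := pow_le_pow_left' h 2
  rw [mul_pow, eLpNorm_two_pow_two, eLpNorm_two_pow_two] at h2
  simp only [hF, sub_sub_sub_cancel_right] at h2
  rw [lintegral_comp_eq_sum ν hpm (fun v => ‖f v - m‖ₑ ^ 2)] at h2
  -- `F - s·F` is constant on the pieces `v ∩ s w` of the common refinement of the partition and its
  -- translate; the mean has cancelled.
  let p₂ : X → {R : Set X // R ∈ P.parts} × {R : Set X // R ∈ P.parts} :=
    fun x => (p x, p (s⁻¹ • x))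
  have hp₂v : ∀ v w, p₂ ⁻¹' {(v, w)} = p ⁻¹' {v} ∩ (fun x => s⁻¹ • x) ⁻¹' (p ⁻¹' {w}) := by
    intro v w; ext x; simp [p₂]
  have hp₂ : ∀ q, MeasurableSet (p₂ ⁻¹' {q}) := by
    rintro ⟨v, w⟩
    rw [hp₂v]
    exact (hpm v).inter (hS _ (hpm w))
  rw [lintegral_comp_eq_sum ν hp₂ (fun q => ‖f q.1 - f q.2‖ₑ ^ 2), Fintype.sum_prod_type] at h2
  simp only [hpv] at h2
  refine h2.trans (Finset.sum_le_sum fun v _ => Finset.sum_le_sum fun w _ => ?_)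
  simp only [hp₂v, hpv]
  by_cases hadj : (approxGraph S ν P).Adj v w
  · rw [if_pos hadj]
    gcongr
    exact inter_subset_left
  · rw [if_neg hadj, zero_mul, nonpos_iff_eq_zero]
    rcases eq_or_ne v w with rfl | hvw
    · simp
    · suffices ν (v.1 ∩ (fun x => s⁻¹ • x) ⁻¹' w.1) = 0 by rw [this, mul_zero]
      rw [approxGraph, SimpleGraph.fromRel_adj] at hadj
      push Not at hadj
      -- The piece lies in `s w ∩ v`, so the relation needed is the one from `w` to `v`, the second
      -- alternative in `fromRel`.
      have h0 := nonpos_iff_eq_zero.1 ((hadj hvw).2 s hs)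
      refine measure_mono_null (fun x hx => ?_) h0
      exact ⟨⟨s⁻¹ • x, hx.2, smul_inv_smul s x⟩, hx.1⟩

/-- The approximating graphs of an action with spectral gap satisfy a Poincaré inequality. -/
theorem hasPoincareInequality_approxGraph [CompleteSpace E] [IsProbabilityMeasure ν]
    (hS : ∀ s : Γ, Measurable fun x : X => s • x) (hP : IsMeasurablePartition P) {ε Q : ℝ≥0}
    (hε0 : 0 < ε)
    (hε : ∀ f : X → E, MemLp f 2 ν → ∫ x, f x ∂ν = 0 →
      ∃ s ∈ S, (ε : ℝ≥0∞) * eLpNorm f 2 ν ≤ eLpNorm (fun x => f x - f (s⁻¹ • x)) 2 ν)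
    (hQ : HasBoundedMeasureRatios ν P Q) :
    HasPoincareInequality (approxGraph S ν P) E (Q ^ 2 / ε ^ 2) := by
  classical
  intro f
  obtain ⟨m, hm⟩ := sum_enorm_sub_sq_le hS hP hε f
  refine ⟨m, ?_⟩
  obtain ⟨x₀⟩ : Nonempty X := by
    by_contra h
    rw [not_nonempty_iff] at h
    exact IsProbabilityMeasure.ne_zero ν (Measure.eq_zero_of_isEmpty ν)
  obtain ⟨p, hp⟩ := P.exists_region
  set v₀ := p x₀
  -- If one region were null, bounded ratios would make all of them null, against total mass one.
  have ha0 : ν v₀.1 ≠ 0 := by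
    intro h0
    have hall : ∀ v : {R : Set X // R ∈ P.parts}, ν v.1 = 0 := fun v => by
      simpa [h0] using hQ v.1 v.2 v₀.1 v₀.2
    have : ν (⋃ v : {R : Set X // R ∈ P.parts}, v.1) = 0 := measure_iUnion_null hall
    rw [show (⋃ v : {R : Set X // R ∈ P.parts}, v.1) = univ from
      eq_univ_of_forall fun x => mem_iUnion.2 ⟨p x, (hp x _).1 rfl⟩, measure_univ] at this
    exact one_ne_zero this
  have hat : ν v₀.1 ≠ ⊤ := measure_ne_top _ _
  have hε1 : (ε : ℝ≥0∞) ^ 2 ≠ 0 := pow_ne_zero _ (by exact_mod_cast hε0.ne')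
  have hε2 : (ε : ℝ≥0∞) ^ 2 ≠ ⊤ := ENNReal.pow_ne_top ENNReal.coe_ne_top
  set A := ∑ v, ‖f v - m‖ₑ ^ 2
  set B := ∑ v, ∑ w, if (approxGraph S ν P).Adj v w then ‖f v - f w‖ₑ ^ 2 else 0 with hB
  -- All weights are replaced by that of the reference region `v₀`, at the cost of one factor `Q` on
  -- each side of the inequality.
  have key : ((ε : ℝ≥0∞) ^ 2 * ν v₀.1) * A ≤ ((ε : ℝ≥0∞) ^ 2 * ν v₀.1) *
      ((Q ^ 2 / ε ^ 2 : ℝ≥0) * B) := by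
    calc ((ε : ℝ≥0∞) ^ 2 * ν v₀.1) * A = ε ^ 2 * ∑ v, ‖f v - m‖ₑ ^ 2 * ν v₀.1 := by
          rw [mul_assoc, mul_comm (ν _), Finset.sum_mul]
      _ ≤ ε ^ 2 * ∑ v, ‖f v - m‖ₑ ^ 2 * (Q * ν v.1) := by
          gcongr with v _
          exact hQ _ v₀.2 _ v.2
      _ = Q * (ε ^ 2 * ∑ v, ‖f v - m‖ₑ ^ 2 * ν v.1) := by
          simp only [mul_left_comm _ (Q : ℝ≥0∞), ← Finset.mul_sum]
      _ ≤ Q * (∑ v, ∑ w,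
          (if (approxGraph S ν P).Adj v w then ‖f v - f w‖ₑ ^ 2 else 0) * ν v.1) := by gcongr
      _ ≤ Q * (∑ v, ∑ w,
          (if (approxGraph S ν P).Adj v w then ‖f v - f w‖ₑ ^ 2 else 0) * (Q * ν v₀.1)) := by
          gcongr with v _ w _
          exact hQ _ v.2 _ v₀.2
      _ = (ε ^ 2 * (Q ^ 2 / ε ^ 2 : ℝ≥0)) * ν v₀.1 * B := by
          simp only [← Finset.sum_mul, ← hB]
          rw [show (ε : ℝ≥0∞) ^ 2 * (Q ^ 2 / ε ^ 2 : ℝ≥0) = Q ^ 2 by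
            norm_cast; field_simp]
          ring
      _ = _ := by ring
  have hAB : A ≤ (Q ^ 2 / ε ^ 2 : ℝ≥0) * B :=
    (ENNReal.mul_le_mul_iff_right (mul_ne_zero hε1 ha0) (ENNReal.mul_ne_top hε2 hat)).1 key
  have hA' : A = ENNReal.ofReal (∑ v, ‖f v - m‖ ^ 2) := by
    rw [ENNReal.ofReal_sum_of_nonneg fun _ _ => by positivity]
    simp only [A, ENNReal.ofReal_pow (norm_nonneg _), ofReal_norm]
  have hite : ∀ v w, (0 : ℝ) ≤
      if (approxGraph S ν P).Adj v w then ‖f v - f w‖ ^ 2 else 0 := fun v w => by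
    split_ifs <;> positivity
  have hB' : B = ENNReal.ofReal
      (∑ v, ∑ w, if (approxGraph S ν P).Adj v w then ‖f v - f w‖ ^ 2 else 0) := by
    rw [ENNReal.ofReal_sum_of_nonneg fun v _ => Finset.sum_nonneg fun w _ => hite v w]
    refine Finset.sum_congr rfl fun v _ => ?_
    rw [ENNReal.ofReal_sum_of_nonneg fun w _ => hite v w]
    refine Finset.sum_congr rfl fun w _ => ?_
    split_ifs
    · rw [ENNReal.ofReal_pow (norm_nonneg _), ofReal_norm]
    · simp
  rw [hA', hB', ← ENNReal.ofReal_coe_nnreal, ← ENNReal.ofReal_mul NNReal.zero_le_coe] at hAB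
  exact (ENNReal.ofReal_le_ofReal_iff (mul_nonneg NNReal.zero_le_coe
    (Finset.sum_nonneg fun v _ => Finset.sum_nonneg fun w _ => hite v w))).1 hAB

/-- The number of regions of partitions of an infinite space with mesh tending to zero tends to
infinity. -/
theorem tendsto_card_parts_of_meshLE {X : Type*} [EMetricSpace X] [Infinite X] {r : ℕ → ℝ}
    (hr : Tendsto r atTop (𝓝 0)) {P : ℕ → Finpartition (univ : Set X)}
    (hP : ∀ n, MeshLE (P n) (r n)) :
    Tendsto (fun n => Nat.card {R : Set X // R ∈ (P n).parts}) atTop atTop := by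
  refine tendsto_atTop.2 fun k => ?_
  obtain ⟨F, hF⟩ := Infinite.exists_subset_card_eq X k
  have hr' : Tendsto (fun n => ENNReal.ofReal (r n)) atTop (𝓝 0) := by
    simpa using ENNReal.tendsto_ofReal hr
  -- Once the mesh is below all distances within a `k`-point set, its points lie in `k` different
  -- regions.
  have hev : ∀ᶠ n in atTop, ∀ x ∈ F, ∀ y ∈ F, x ≠ y → ENNReal.ofReal (r n) < edist x y := by
    rw [Filter.eventually_all_finset]
    intro x _
    rw [Filter.eventually_all_finset]
    intro y _
    by_cases hxy : x = y
    · simp [hxy]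
    · filter_upwards [hr'.eventually_lt_const (edist_pos.2 hxy)] with n hn _ using hn
  filter_upwards [hev] with n hn
  obtain ⟨p, hp⟩ := (P n).exists_region
  rw [← hF, Nat.card_eq_fintype_card, ← Finset.card_univ]
  refine Finset.card_le_card_of_injOn p (fun _ _ => Finset.mem_univ _) fun x hx y hy hxy => ?_
  by_contra hne
  exact absurd ((Metric.edist_le_ediam_of_mem ((hp x (p x)).1 rfl) ((hp y (p x)).1 hxy.symm)).trans
    (hP n _ (p x).2)) (not_le.2 (hn x hx y hy hne))

/-- The approximating graphs of finer and finer partitions, for an action with spectral gap. -/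
theorem HasSpectralGap.isExpander_and_not_coarselyEmbeds {X : Type*} [EMetricSpace X] [Infinite X]
    [MeasurableSpace X] {ν : Measure X} [MulAction Γ X] [IsProbabilityMeasure ν]
    [CompleteSpace E] [Nontrivial E] (hgap : HasSpectralGap S ν E)
    (hS : ∀ s : Γ, Measurable fun x : X => s • x)
    {r : ℕ → ℝ} (hr : Tendsto r atTop (𝓝 0)) {P : ℕ → Finpartition (univ : Set X)}
    (hP : ∀ n, IsMeasurablePartition (P n)) (hmesh : ∀ n, MeshLE (P n) (r n))
    {Q : ℝ≥0} (hQ : ∀ n, HasBoundedMeasureRatios ν (P n) Q)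
    {D : ℕ} (hD : ∀ n, DegreeBoundedBy (approxGraph S ν (P n)) D) :
    IsExpander (fun n => approxGraph S ν (P n)) ∧
      ¬ CoarselyEmbeds (fun n => approxGraph S ν (P n)) E := by
  obtain ⟨ε, hε0, hε⟩ := hgap
  have : ∀ n, Nonempty {R : Set X // R ∈ (P n).parts} := fun n =>
    ⟨(P n).exists_region.choose (Classical.arbitrary X)⟩
  -- Enlarging `Q` makes the Poincaré constant positive.
  have hQ' : ∀ n, HasBoundedMeasureRatios ν (P n) (Q + 1) := fun n R hR R' hR' =>
    (hQ n R hR R' hR').trans (by gcongr; exact le_self_add)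
  exact _root_.isExpander_and_not_coarselyEmbeds (K := (Q + 1) ^ 2 / ε ^ 2) (by positivity) hD
    (tendsto_card_parts_of_meshLE hr hmesh)
    fun n => hasPoincareInequality_approxGraph hS (hP n) hε0 hε (hQ' n)

end Partition

/-! ### Existence and bounded geometry of level partitions. -/

section LevelPartition

/-- A compact space contains a finite maximal `r`-separated set. -/
theorem exists_finite_separated_dense {X : Type*} [PseudoEMetricSpace X] [CompactSpace X]
    {r : ℝ≥0∞} (hr : 0 < r) :
    ∃ Y : Set X, Y.Finite ∧ Y.Pairwise (fun x y => r ≤ edist x y) ∧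
      ∀ x, ∃ y ∈ Y, edist x y < r := by
  obtain ⟨Y, -, hY⟩ := zorn_subset_nonempty {Y : Set X | Y.Pairwise fun x y => r ≤ edist x y}
    (fun c hc hchain _ => ⟨⋃₀ c, (pairwise_sUnion hchain.directedOn).2 hc,
      fun _ => subset_sUnion_of_mem⟩) ∅ (pairwise_empty _)
  refine ⟨Y, ?_, hY.prop, fun x => ?_⟩
  · obtain ⟨F, -, hF⟩ := isCompact_univ.elim_nhds_subcover (fun x : X => Metric.eball x (r / 2))
      fun x _ => Metric.eball_mem_nhds x (ENNReal.half_pos hr.ne')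
    have hF' : ∀ x : X, ∃ z ∈ F, edist x z < r / 2 := fun x => by
      simpa using hF (mem_univ x)
    choose z hz hxz using hF'
    refine Set.Finite.of_finite_image (F.finite_toSet.subset (image_subset_iff.2 fun x _ => hz x))
      (f := z) fun x hx y hy hxy => ?_
    by_contra hne
    refine absurd (hY.prop hx hy hne) (not_le.2 ?_)
    calc edist x y ≤ edist x (z x) + edist y (z x) := edist_triangle_right _ _ _
      _ < r / 2 + r / 2 := ENNReal.add_lt_add (hxz x) (by rw [hxy]; exact hxz y)
      _ = r := ENNReal.add_halves r
  · by_contra! h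
    have hins : (insert x Y).Pairwise fun x y => r ≤ edist x y :=
      hY.prop.insert fun y hy _ => ⟨h y hy, by rw [edist_comm]; exact h y hy⟩
    have hx : x ∈ Y := hY.le_of_ge hins (subset_insert x Y) (mem_insert x Y)
    exact absurd (h x hx) (by simpa using hr.ne')

/-- Level partitions exist at all scales: Voronoi tessellations, with ties broken according to an
enumeration of the centres. -/
theorem exists_isLevelPartition {X : Type*} [PseudoEMetricSpace X] [CompactSpace X]
    [MeasurableSpace X] [BorelSpace X] {t : ℝ} (ht : 0 < t) :
    ∃ P : Finpartition (univ : Set X), IsLevelPartition t P := by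
  classical
  have hr : 0 < ENNReal.ofReal (1 / t) := ENNReal.ofReal_pos.2 (by positivity)
  have hρ : 0 < ENNReal.ofReal (1 / (2 * t)) := ENNReal.ofReal_pos.2 (by positivity)
  have hρr : ENNReal.ofReal (1 / (2 * t)) + ENNReal.ofReal (1 / (2 * t)) =
      ENNReal.ofReal (1 / t) := by
    rw [← ENNReal.ofReal_add (by positivity) (by positivity)]
    congr 1
    field_simp
    norm_num
  set r := ENNReal.ofReal (1 / t)
  set ρ := ENNReal.ofReal (1 / (2 * t))
  obtain ⟨Y, hYfin, hYsep, hYdense⟩ := exists_finite_separated_dense (X := X) hr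
  obtain ⟨k, ⟨e⟩⟩ : ∃ k, Nonempty (Y ≃ Fin k) := by
    have := hYfin.to_subtype
    exact ⟨_, ⟨Finite.equivFin Y⟩⟩
  let y : Fin k → X := fun i => (e.symm i : X)
  have hysep : ∀ i j, i ≠ j → r ≤ edist (y i) (y j) := fun i j hij =>
    hYsep (e.symm i).2 (e.symm j).2 fun h => hij (e.symm.injective (Subtype.ext h))
  have hydense : ∀ x, ∃ i, edist x (y i) < r := fun x => by
    obtain ⟨z, hz, hxz⟩ := hYdense x
    exact ⟨e ⟨z, hz⟩, by simpa [y] using hxz⟩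
  let R : Fin k → Set X := fun i =>
    {x | (∀ j, edist x (y i) ≤ edist x (y j)) ∧ ∀ j < i, edist x (y i) < edist x (y j)}
  -- Centres are at least `r = ρ + ρ` apart, so within `ρ` of `y i` no other centre is as close and
  -- no tie occurs.
  have hball : ∀ i, Metric.eball (y i) ρ ⊆ R i := by
    intro i x hx
    have hlt : ∀ j, j ≠ i → edist x (y i) < edist x (y j) := by
      intro j hj
      by_contra! hle
      refine absurd (hysep i j hj.symm) (not_le.2 ?_)
      calc edist (y i) (y j) ≤ edist x (y i) + edist x (y j) := edist_triangle_left _ _ _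
        _ < ρ + ρ := ENNReal.add_lt_add hx (hle.trans_lt hx)
        _ = r := hρr
    refine ⟨fun j => ?_, fun j hj => hlt j hj.ne⟩
    rcases eq_or_ne j i with rfl | hj
    · exact le_rfl
    · exact (hlt j hj).le
  have hball' : ∀ i, R i ⊆ Metric.eball (y i) r := by
    intro i x hx
    obtain ⟨j, hj⟩ := hydense x
    exact (hx.1 j).trans_lt hj
  have hdisj : ∀ i j, i ≠ j → Disjoint (R i) (R j) := by
    intro i j hij
    refine Set.disjoint_left.2 fun x hi hj => ?_
    rcases lt_or_gt_of_ne hij with h | h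
    · exact absurd (hi.1 j) (not_le.2 (hj.2 i h))
    · exact absurd (hj.1 i) (not_le.2 (hi.2 j h))
  have hmem : ∀ i, y i ∈ R i := fun i => hball i (Metric.mem_eball_self hρ)
  -- Injectivity ensures that the index chosen below for the region `R i` is `i` itself.
  have hinj : Function.Injective R := fun i j hij => by
    by_contra hne
    exact Set.disjoint_left.1 (hdisj i j hne) (hmem i) (hij ▸ hmem i)
  have hcover : ∀ x, ∃ i, x ∈ R i := by
    intro x
    have : Nonempty (Fin k) := ⟨(hydense x).choose⟩
    obtain ⟨i₀, hi₀⟩ := Finite.exists_min fun i => edist x (y i)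
    have hne : (Finset.univ.filter fun i => ∀ j, edist x (y i) ≤ edist x (y j)).Nonempty :=
      ⟨i₀, by simpa using hi₀⟩
    have hmin := Finset.min'_mem _ hne
    set i := Finset.min' _ hne with hi
    simp only [Finset.mem_filter, Finset.mem_univ, true_and] at hmin
    refine ⟨i, hmin, fun j hj => lt_of_le_of_ne (hmin j) fun heq => ?_⟩
    refine absurd (Finset.min'_le _ j ?_) (not_le.2 (hi ▸ hj))
    simpa using fun l => heq ▸ hmin l
  have hmeas : ∀ i, MeasurableSet (R i) := by
    intro i
    have hcont : ∀ j, Continuous fun x => edist x (y j) := fun j =>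
      continuous_id.edist continuous_const
    have hRi : R i = (⋂ j, {x | edist x (y i) ≤ edist x (y j)}) ∩
        ⋂ j, ⋂ (_ : j < i), {x | edist x (y i) < edist x (y j)} := by
      ext x
      simp [R]
    rw [hRi]
    exact (MeasurableSet.iInter fun j => (isClosed_le (hcont i) (hcont j)).measurableSet).inter
      (MeasurableSet.iInter fun j => MeasurableSet.iInter fun _ =>
        (isOpen_lt (hcont i) (hcont j)).measurableSet)
  let P : Finpartition (univ : Set X) :=
    { parts := Finset.univ.image R
      supIndep := by
        rw [Finset.supIndep_iff_pairwiseDisjoint]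
        intro A hA B hB hAB
        simp only [Finset.coe_image, Finset.coe_univ, image_univ, mem_range] at hA hB
        obtain ⟨i, rfl⟩ := hA
        obtain ⟨j, rfl⟩ := hB
        exact hdisj i j fun h => hAB (h ▸ rfl)
      sup_parts := by
        rw [Finset.sup_id_set_eq_sUnion]
        refine eq_univ_of_forall fun x => ?_
        obtain ⟨i, hi⟩ := hcover x
        exact ⟨R i, by simp, hi⟩
      bot_notMem := by
        simp only [Finset.mem_image, Finset.mem_univ, true_and, not_exists]
        exact fun i hi => (hi ▸ hmem i : y i ∈ (⊥ : Set X)) }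
  have hidx : ∀ A : {A : Set X // A ∈ P.parts}, ∃ i, R i = A.1 := fun A => by
    obtain ⟨i, -, hi⟩ := Finset.mem_image.1 A.2
    exact ⟨i, hi⟩
  choose idx hidx using hidx
  refine ⟨P, ⟨fun A hA => ?_, fun A => y (idx A), fun A B hAB => ?_, fun x => ?_, fun A => ?_⟩⟩
  · have hA' : R (idx ⟨A, hA⟩) = A := hidx ⟨A, hA⟩
    exact hA' ▸ hmeas _
  · exact hysep _ _ fun h => hAB (Subtype.ext (by rw [← hidx A, ← hidx B, h]))
  · obtain ⟨i, hi⟩ := hydense x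
    have hRi : R i ∈ P.parts := Finset.mem_image_of_mem R (Finset.mem_univ i)
    have hidx_i : idx ⟨R i, hRi⟩ = i := hinj (hidx ⟨R i, hRi⟩)
    refine ⟨⟨R i, hRi⟩, ?_⟩
    change edist x (y (idx ⟨R i, hRi⟩)) < r
    rwa [hidx_i]
  · rw [← hidx A]
    exact ⟨hball _, hball' _⟩

variable {X : Type*} [EMetricSpace X] [MeasurableSpace X] [BorelSpace X]
  {t : ℝ} {P : Finpartition (univ : Set X)}

omit [BorelSpace X] in
theorem IsLevelPartition.meshLE (h : IsLevelPartition t P) : MeshLE P (2 / t) := by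
  obtain ⟨y, -, -, hy⟩ := h.exists_net
  intro R hR
  refine (Metric.ediam_mono (hy ⟨R, hR⟩).2).trans (Metric.ediam_eball_le.trans_eq ?_)
  rw [← ENNReal.ofReal_ofNat 2, ← ENNReal.ofReal_mul (by norm_num), mul_one_div]

variable {ν : Measure X} {Q : ℝ≥0}

omit [BorelSpace X] in
theorem ofReal_one_div_eq_two_mul (ht : 0 < t) :
    ENNReal.ofReal (1 / t) = 2 * ((1 / (2 * t)).toNNReal : ℝ≥0∞) := by
  change _ = 2 * ENNReal.ofReal (1 / (2 * t))
  rw [← ENNReal.ofReal_ofNat 2, ← ENNReal.ofReal_mul (by norm_num)]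
  congr 1
  field_simp

omit [BorelSpace X] in
-- With `ρ = 1 / (2t)`, each region contains a ball of radius `ρ` and lies in one of radius `2ρ`,
-- hence in one of radius `5ρ`.
theorem IsLevelPartition.hasBoundedMeasureRatios (h : IsLevelPartition t P) (ht : 0 < t)
    (hQ : ∀ (y y' : X) (ρ : ℝ≥0), 0 < ρ →
      ν (Metric.eball y (5 * ρ)) ≤ Q * ν (Metric.eball y' ρ)) :
    HasBoundedMeasureRatios ν P Q := by
  obtain ⟨y, -, -, hy⟩ := h.exists_net
  intro R hR R' hR'
  have hρ : 0 < (1 / (2 * t)).toNNReal := Real.toNNReal_pos.2 (by positivity)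
  calc ν R ≤ ν (Metric.eball (y ⟨R, hR⟩) (5 * (1 / (2 * t)).toNNReal)) := by
        refine measure_mono ((hy ⟨R, hR⟩).2.trans (Metric.eball_subset_eball ?_))
        rw [ofReal_one_div_eq_two_mul ht]
        gcongr
        norm_num
    _ ≤ Q * ν (Metric.eball (y ⟨R', hR'⟩) (1 / (2 * t)).toNNReal) := hQ _ _ _ hρ
    _ ≤ Q * ν R' := by
        gcongr
        exact (hy ⟨R', hR'⟩).1

/-- Under a comparability assumption on the measures of balls, every ball of radius `2 / t` meets
a bounded number of centres of a level-`t` partition. -/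
theorem card_filter_edist_lt_le [IsProbabilityMeasure ν] {ρ : ℝ≥0} (hρ : 0 < ρ)
    (hQ : ∀ (y y' : X) (ρ : ℝ≥0), 0 < ρ →
      ν (Metric.eball y (5 * ρ)) ≤ Q * ν (Metric.eball y' ρ))
    {y : {R : Set X // R ∈ P.parts} → X}
    (hy : ∀ R, Metric.eball (y R) ρ ⊆ R.1 ∧ R.1 ⊆ Metric.eball (y R) (2 * ρ))
    (W : Finset {R : Set X // R ∈ P.parts}) (z : X) (hW : ∀ R ∈ W, edist z (y R) < 4 * ρ) :
    W.card ≤ ⌈Q⌉₊ := by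
  set a := ν (Metric.eball z (5 * ρ))
  have hat : a ≠ ⊤ := measure_ne_top _ _
  -- If this ball were null, the comparison would make every region null.
  have ha0 : a ≠ 0 := by
    intro h0
    have hz : ν (Metric.eball z ρ) = 0 := by
      refine measure_mono_null (Metric.eball_subset_eball ?_) h0
      calc (ρ : ℝ≥0∞) = 1 * ρ := (one_mul _).symm
        _ ≤ 5 * ρ := by gcongr; norm_num
    have hR : ∀ R : {R : Set X // R ∈ P.parts}, ν R.1 = 0 := fun R => by
      refine measure_mono_null ((hy R).2.trans (Metric.eball_subset_eball ?_))
        (nonpos_iff_eq_zero.1 ((hQ (y R) z ρ hρ).trans_eq (by rw [hz, mul_zero])))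
      gcongr
      norm_num
    obtain ⟨p, hp⟩ := P.exists_region
    have : ν (⋃ v : {R : Set X // R ∈ P.parts}, v.1) = 0 := measure_iUnion_null hR
    rw [show (⋃ v : {R : Set X // R ∈ P.parts}, v.1) = univ from
      eq_univ_of_forall fun x => mem_iUnion.2 ⟨p x, (hp x _).1 rfl⟩, measure_univ] at this
    exact one_ne_zero this
  -- Packing: the balls of radius `ρ` about the centres are disjoint and lie in the ball of radius
  -- `4ρ + ρ` about `z`, and `Q` times the measure of each is at least that of the large ball.
  have hdisj : (W : Set {R : Set X // R ∈ P.parts}).PairwiseDisjoint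
      fun R => Metric.eball (y R) ρ := fun R _ R' _ hne =>
    Set.disjoint_left.2 fun x hx hx' =>
      hne (P.eq_of_mem_of_mem ((hy R).1 hx) ((hy R').1 hx'))
  have hsum : ∑ R ∈ W, ν (Metric.eball (y R) ρ) ≤ a := by
    rw [← measure_biUnion_finset hdisj fun R _ => Metric.isOpen_eball.measurableSet]
    refine measure_mono (iUnion₂_subset fun R hR x hx => ?_)
    calc edist x z ≤ edist x (y R) + edist z (y R) := edist_triangle_right _ _ _
      _ < ρ + 4 * ρ := ENNReal.add_lt_add hx (hW R hR)
      _ = 5 * ρ := by ring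
  have hmul : (W.card : ℝ≥0∞) * a ≤ Q * a := by
    calc (W.card : ℝ≥0∞) * a = ∑ R ∈ W, a := by rw [Finset.sum_const, nsmul_eq_mul]
      _ ≤ ∑ R ∈ W, Q * ν (Metric.eball (y R) ρ) := Finset.sum_le_sum fun R _ => hQ _ _ _ hρ
      _ = Q * ∑ R ∈ W, ν (Metric.eball (y R) ρ) := Finset.mul_sum _ _ _ |>.symm
      _ ≤ Q * a := by gcongr
  have hle : (W.card : ℝ≥0∞) ≤ Q := (ENNReal.mul_le_mul_iff_left ha0 hat).1 hmul
  have hle' : (W.card : ℝ≥0) ≤ Q := by exact_mod_cast hle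
  exact_mod_cast hle'.trans (Nat.le_ceil Q)

/-- Since `s` is an isometry and regions lie within `2ρ` of their centres, an edge due to `s` puts
the centre of the neighbour within `4ρ` of `s • y v` or of `s⁻¹ • y v`, according to its direction.
`card_filter_edist_lt_le` counts the centres in both places. -/
theorem IsLevelPartition.degreeBoundedBy [IsProbabilityMeasure ν] {Γ : Type*} [Group Γ]
    [MulAction Γ X] [IsIsometricSMul Γ X] (S : Finset Γ) (h : IsLevelPartition t P) (ht : 0 < t)
    (hQ : ∀ (y y' : X) (ρ : ℝ≥0), 0 < ρ →
      ν (Metric.eball y (5 * ρ)) ≤ Q * ν (Metric.eball y' ρ)) :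
    DegreeBoundedBy (approxGraph S ν P) (S.card * (2 * ⌈Q⌉₊)) := by
  classical
  obtain ⟨y, -, -, hy⟩ := h.exists_net
  rw [ofReal_one_div_eq_two_mul ht] at hy
  change ∀ R, Metric.eball (y R) ((1 / (2 * t)).toNNReal) ⊆ R.1 ∧ _ at hy
  have hρ : 0 < (1 / (2 * t)).toNNReal := Real.toNNReal_pos.2 (by positivity)
  set ρ := (1 / (2 * t)).toNNReal
  intro v
  refine ⟨Set.toFinite _, ?_⟩
  let W : X → Finset {R : Set X // R ∈ P.parts} := fun z =>
    Finset.univ.filter fun R => edist z (y R) < 4 * ρ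
  have hWcard : ∀ z, (W z).card ≤ ⌈Q⌉₊ := fun z =>
    card_filter_edist_lt_le hρ hQ hy (W z) z fun R hR => by simpa [W] using hR
  have hsmul : ∀ (s : Γ) (R R' : {R : Set X // R ∈ P.parts}),
      0 < ν (((fun x => s • x) '' R.1) ∩ R'.1) → edist (s • y R) (y R') < 4 * ρ := by
    intro s R R' hpos
    obtain ⟨_, ⟨x, hx, rfl⟩, hx'⟩ := nonempty_of_measure_ne_zero hpos.ne'
    calc edist (s • y R) (y R') ≤ edist (s • x) (s • y R) + edist (s • x) (y R') :=
          edist_triangle_left _ _ _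
      _ = edist x (y R) + edist (s • x) (y R') := by rw [edist_smul_left]
      _ < 2 * ρ + 2 * ρ := ENNReal.add_lt_add ((hy R).2 hx) ((hy R').2 hx')
      _ = 4 * ρ := by ring
  have hsub : (approxGraph S ν P).neighborSet v ⊆
      (S.biUnion fun s => W (s • y v) ∪ W (s⁻¹ • y v) :
        Finset {R : Set X // R ∈ P.parts}) := by
    intro w hw
    rw [SimpleGraph.mem_neighborSet, approxGraph, SimpleGraph.fromRel_adj] at hw
    simp only [Finset.coe_biUnion, Finset.coe_union, mem_iUnion, mem_union, Finset.mem_coe, W,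
      Finset.mem_filter, Finset.mem_univ, true_and]
    rcases hw.2 with ⟨s, hs, hpos⟩ | ⟨s, hs, hpos⟩
    · exact ⟨s, hs, Or.inl (hsmul s v w hpos)⟩
    · refine ⟨s, hs, Or.inr ?_⟩
      rw [edist_comm, ← edist_smul_left s, smul_inv_smul]
      exact hsmul s w v hpos
  refine (Set.ncard_le_ncard hsub (Finset.finite_toSet _)).trans ?_
  rw [Set.ncard_coe_finset]
  refine Finset.card_biUnion_le_card_mul _ _ _ fun s _ => ?_
  refine (Finset.card_union_le _ _).trans ?_
  rw [two_mul]
  exact add_le_add (hWcard _) (hWcard _)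

end LevelPartition

theorem mainTheorem7
    -- a non-empty compact Riemannian manifold `M` of dimension `d ≥ 1`, with its distance
    {d : ℕ} (hd : 0 < d) {M : Type*} [EMetricSpace M] [ChartedSpace (EuclideanSpace ℝ (Fin d)) M]
    [IsManifold (𝓡 d) ∞ M]
    [Bundle.RiemannianBundle (fun x : M => TangentSpace (𝓡 d) x)]
    [IsContMDiffRiemannianBundle (𝓡 d) ∞ (EuclideanSpace ℝ (Fin d))
      (fun x : M => TangentSpace (𝓡 d) x)]
    [IsRiemannianManifold (𝓡 d) M]
    [CompactSpace M] [Nonempty M] [MeasurableSpace M] [BorelSpace M]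
    -- a group `Γ` with a finite symmetric generating set `S`, acting by isometries on `M`
    {Γ : Type*} [Group Γ] (S : Finset Γ) (hSsymm : ∀ s ∈ S, s⁻¹ ∈ S)
    (hSgen : Subgroup.closure (S : Set Γ) = ⊤)
    [MulAction Γ M] [IsIsometricSMul Γ M]
    -- a non-zero Banach space `E` such that the action has `E`-spectral gap
    {E : Type*} [NormedAddCommGroup E] [NormedSpace ℝ E] [CompleteSpace E] [Nontrivial E]
    (hgap : HasSpectralGap S (normalizedVolume d M) E) :
    -- partitions at scale `1/t` exist,
    (∀ t : ℝ, 1 ≤ t → ∃ P : Finpartition (Set.univ : Set M), IsLevelPartition t P) ∧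
    -- their approximating graphs form an expander that does not coarsely embed into `E`,
    (∀ t : ℕ → ℝ, (∀ n, 1 ≤ t n) → Monotone t → Tendsto t atTop atTop →
      ∀ P : ℕ → Finpartition (Set.univ : Set M), (∀ n, IsLevelPartition (t n) (P n)) →
        IsExpander (fun n => approxGraph S (normalizedVolume d M) (P n)) ∧
        ¬ CoarselyEmbeds (fun n => approxGraph S (normalizedVolume d M) (P n)) E) ∧
    -- and so do the approximating graphs, if they have uniformly bounded degrees, of any measurable
    -- partitions of mesh `O(1/t)` with uniformly bounded measure ratios
    (∀ t : ℕ → ℝ, (∀ n, 1 ≤ t n) → Monotone t → Tendsto t atTop atTop →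
      ∀ P : ℕ → Finpartition (Set.univ : Set M), (∀ n, IsMeasurablePartition (P n)) →
      ∀ (C : ℝ) (Q : ℝ≥0) (D : ℕ), (∀ n, MeshLE (P n) (C / t n)) →
        (∀ n, HasBoundedMeasureRatios (normalizedVolume d M) (P n) Q) →
        (∀ n, DegreeBoundedBy (approxGraph S (normalizedVolume d M) (P n)) D) →
        IsExpander (fun n => approxGraph S (normalizedVolume d M) (P n)) ∧
        ¬ CoarselyEmbeds (fun n => approxGraph S (normalizedVolume d M) (P n)) E) := by
  have := isProbabilityMeasure_normalizedVolume d M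
  -- A finite `M` would be a finite union of null points.
  have : Infinite M := by
    by_contra hfin
    rw [not_infinite_iff_finite] at hfin
    have h0 : normalizedVolume d M (⋃ x : M, {x}) = 0 :=
      measure_iUnion_null fun x => normalizedVolume_singleton hd x
    rw [iUnion_of_singleton, measure_univ] at h0
    exact one_ne_zero h0
  have hmeas : ∀ s : Γ, Measurable fun x : M => s • x := fun s =>
    (isometry_smul M s).continuous.measurable
  have hmesh : ∀ (C : ℝ) (t : ℕ → ℝ), Tendsto t atTop atTop →
      Tendsto (fun n => C / t n) atTop (𝓝 0) := fun C t ht => ht.const_div_atTop C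
  refine ⟨fun t ht => exists_isLevelPartition (by linarith), ?_, ?_⟩
  · intro t ht _ htop P hP
    obtain ⟨Q, hQ⟩ := exists_normalizedVolume_eball_le d M
    have ht0 : ∀ n, 0 < t n := fun n => by linarith [ht n]
    exact hgap.isExpander_and_not_coarselyEmbeds hmeas (hmesh 2 t htop)
      (fun n => (hP n).measurable) (fun n => (hP n).meshLE)
      (fun n => (hP n).hasBoundedMeasureRatios (ht0 n) hQ)
      (fun n => (hP n).degreeBoundedBy S (ht0 n) hQ)
  · intro t _ _ htop P hP C Q D hC hQ hD
    exact hgap.isExpander_and_not_coarselyEmbeds hmeas (hmesh C t htop) hP hC hQ hD
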